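/- **Setting.** Fix $N\in\mathbb N$ and $r>0$; put $C_r=\overline{B_r}\times\overline{B_r}\subset\mathbb R^N\times\mathbb R^N$. For $A,B\subseteq\mathbb R^N$ let $\operatorname{dist}(A,B)=\inf\{|x-y|:x\in A,\,y\in B\}\in[0,+\infty]$, which is $+\infty$ if $A$ or $B$ is empty. For $E\subseteq\mathbb R^N\times[0,\infty)$ put $E(t)=\{x:(x,t)\in E\}$; let $(A)_\delta=\bigcup_{x\in A}B_\delta(x)$, so that $(\emptyset)_\delta=\emptyset$. For $T\in[0,+\infty]$, let $L^\infty_{\mathbf w}(\mathbb R^N\times(0,T);\mathcal M^+(C_r))$ be the set of maps $z$ from $\mathbb R^N\times(0,T)$ to the nonnegative Radon measures on $C_r$ such that $(w,t)\mapsto\int_{C_r} f\,dz_{(w,t)}$ is Lebesgue measurable for every $f\in C^0(C_r)$ and $(w,t)\mapsto z_{(w,t)}(C_r)$ is essentially bounded. The nonlocal divergence of such a $z$ is the signed Radon measure $\mathfrak{Div}^r z$ on $\mathbb R^N\times(0,T)$ with $$\int\varphi\,d(\mathfrak{Div}^rz)=-\frac1{2r}\int_0^T\!\int_{\mathbb R^N}\!\int_{C_r}\big(\varphi(w+x,t)-\varphi(w+y,t)\big)\,dz_{(w,t)}(x,y)\,dw\,dt\qquad\text{for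 all }\varphi\in C^0_c(\mathbb R^N\times(0,T)).$$ **Weak superflows.** Let $E^0\subseteq\mathbb R^N$ be closed with compact boundary. A closed set $E\subseteq\mathbb R^N\times[0,\infty)$ is a *weak superflow* of the Minkowski flow $V=-\mathcal K_r$ with initial datum $E^0$ if (a) $E(0)\subseteq E^0$, and either $E(t)$ is bounded for all $t\ge0$ or $\mathbb R^N\setminus E(t)$ is bounded for all $t\ge0$; (b) for all $t\ge0$ and $\delta>0$ there is $\tau>0$ such that $E(s)\subseteq(E(t))_\delta$ for all $s\in(t,t+\tau)$; (c) for all $t>0$, $E(s)\to E(t)$ in the sense of Kuratowski as $s\nearrow t$; that is, for all $s_n\in[0,t)$ with $s_n\to t$, every cluster point of every sequence $x_n\in E(s_n)$ lies in $E(t)$, and every $x\in E(t)$ is the limit of a sequence $x_n\in E(s_n)$; (d) with $T^{\rm ext}=\inf\{t>0: E(s)=\emptyset\ \forall s\ge t\}\in[0,+\infty]$ and $d(x,t)=\operatorname{dist}(x,E(t))$, there is $z\in L^\infty_{\mathbf w}(\mathbb R^N\times(0,T^{\rm ext});\mathcal M^+(C_r))$ such that - (d1) $d$ is locally integrable in the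 open set $(\mathbb R^N\times(0,T^{\rm ext}))\setminus E$ and $\partial_td\ge\mathfrak{Div}^rz$ there in the sense of distributions (tested with nonnegative $C^\infty_c$ functions), equivalently as measures; - (d2) for a.e. $(w,t)\in\mathbb R^N\times(0,T^{\rm ext})$ one has $z_{(w,t)}(C_r)\le1$ and $\int_{C_r}(d(w+x,t)-d(w+y,t))\,dz_{(w,t)}(x,y)=\operatorname*{osc}_{B_r(w)}d(\cdot,t)$, where $\operatorname{osc}$ is the essential supremum minus the essential infimum; - (d3) for every $\lambda>0$, the positive part $(\mathfrak{Div}^rz)^+$, restricted to $\{(w,t)\in\mathbb R^N\times(0,T^{\rm ext}): d(w,t)\ge\lambda\}$, is absolutely continuous with respect to Lebesgue measure with density in $L^\infty$. **Weak subflows.** A relatively open set $A\subseteq\mathbb R^N\times[0,\infty)$ is a *weak subflow* with initial datum $E^0$ if $(\mathbb R^N\times[0,\infty))\setminus A$ is a weak superflow with initial datum $\mathbb R^N\setminus\operatorname{Int}(E^0)$. **Theorem.** Let $E^0,F^0\subseteq\mathbb R^N$ be closed sets with compact boundary, let $E$ be a weak superflow with initial datum $E^0$ and $F$ a weak subflow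 with initial datum $F^0$. If $\Delta:=\operatorname{dist}(E^0,\mathbb R^N\setminus F^0)>0$, then $$\operatorname{dist}(E(t),\mathbb R^N\setminus F(t))\ \ge\ \Delta\qquad\text{for all }t\ge0.$$ -/

import Mathlib

open MeasureTheory Set Filter
open scoped Topology NNReal ContDiff

namespace MinkowskiFlow

/-- The Euclidean space `ℝ^N`. -/
abbrev Space (N : ℕ) : Type := EuclideanSpace ℝ (Fin N)

/-- The distance `inf {|x - y| : x ∈ A, y ∈ B}` of two sets, equal to `+∞` if one of them is
empty. -/
noncomputable def setDist {N : ℕ} (A B : Set (Space N)) : ENNReal :=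
  ⨅ x ∈ A, ⨅ y ∈ B, edist x y

/-- The closed half space-time `ℝ^N × [0, ∞)`, as a subset of `ℝ^N × ℝ`. -/
def halfSpace (N : ℕ) : Set (Space N × ℝ) := {p | 0 ≤ p.2}

/-- The time slice `E(t) = {x : (x, t) ∈ E}`. -/
def slice {N : ℕ} (E : Set (Space N × ℝ)) (t : ℝ) : Set (Space N) := {x | (x, t) ∈ E}

/-- Kuratowski convergence of a sequence of sets `D n` to the set `D'`. -/
def KuratowskiTendsto {N : ℕ} (D : ℕ → Set (Space N)) (D' : Set (Space N)) : Prop :=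
  (∀ u : ℕ → Space N, (∀ n, u n ∈ D n) → ∀ x, MapClusterPt x atTop u → x ∈ D') ∧
  (∀ x ∈ D', ∃ u : ℕ → Space N, (∀ n, u n ∈ D n) ∧ Tendsto u atTop (𝓝 x))

/-- The extinction time `inf {t > 0 : E(s) = ∅ for all s ≥ t}`, equal to `+∞` if there is no such
`t`. -/
noncomputable def extinctionTime {N : ℕ} (E : Set (Space N × ℝ)) : EReal :=
  ⨅ t ∈ {t : ℝ | 0 < t ∧ ∀ s, t ≤ s → slice E s = ∅}, (t : EReal)

/-- The open space-time cylinder `ℝ^N × (0, T)`, where `T` may be `+∞`. -/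
def spaceTimeCylinder (N : ℕ) (T : EReal) : Set (Space N × ℝ) := {p | 0 < p.2 ∧ (p.2 : EReal) < T}

/-- The function `d(x, t) = dist(x, E(t))`. -/
noncomputable def distTo {N : ℕ} (E : Set (Space N × ℝ)) (p : Space N × ℝ) : ℝ :=
  Metric.infDist p.1 (slice E p.2)

/-- The essential oscillation `ess sup_A v - ess inf_A v`. It is only used for functions that are
bounded on a set `A` of positive measure. -/
noncomputable def essOsc {N : ℕ} (A : Set (Space N)) (v : Space N → ℝ) : ℝ :=
  essSup v (volume.restrict A) - essInf v (volume.restrict A)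

/-- The compact set `C_r = closedBall 0 r × closedBall 0 r`. -/
def Cr (N : ℕ) (r : ℝ) : Set (Space N × Space N) :=
  Metric.closedBall 0 r ×ˢ Metric.closedBall 0 r

/-- The weak-star measurable, essentially bounded maps from `ℝ^N × (0, T)` to the nonnegative
Radon measures on `C_r`. A Radon measure on the compact set `C_r` is a finite Borel measure
on `ℝ^N × ℝ^N` that vanishes outside `C_r`; the values of `z` outside the cylinder do not matter. -/
structure IsMeasureField {N : ℕ} (r : ℝ) (T : EReal)
    (z : Space N × ℝ → Measure (Space N × Space N)) : Prop where
  finite : ∀ p ∈ spaceTimeCylinder N T, IsFiniteMeasure (z p)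
  concentrated : ∀ p ∈ spaceTimeCylinder N T, z p (Cr N r)ᶜ = 0
  measurable : ∀ f : Space N × Space N → ℝ, Continuous f →
    AEMeasurable (fun p => ∫ q, f q ∂(z p)) (volume.restrict (spaceTimeCylinder N T))
  bounded : ∃ M : ℝ≥0, ∀ᵐ p ∂(volume.restrict (spaceTimeCylinder N T)), z p (Cr N r) ≤ M

/-- `μpos` and `μneg` are the positive and the negative part of the nonlocal divergence
`Div^r z`, which is the signed Radon measure on `ℝ^N × (0, T)` such that
`∫ φ d(Div^r z) = -1/(2r) ∫∫∫ (φ(w + x, t) - φ(w + y, t)) dz_{(w,t)}(x, y) dw dt`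
for all continuous `φ` with compact support in `ℝ^N × (0, T)`. -/
structure IsNonlocalDivergence {N : ℕ} (r : ℝ) (T : EReal)
    (z : Space N × ℝ → Measure (Space N × Space N)) (μpos μneg : Measure (Space N × ℝ)) :
    Prop where
  pos_radon : ∀ K, IsCompact K → K ⊆ spaceTimeCylinder N T → μpos K < ⊤
  neg_radon : ∀ K, IsCompact K → K ⊆ spaceTimeCylinder N T → μneg K < ⊤
  pos_compl : μpos (spaceTimeCylinder N T)ᶜ = 0
  neg_compl : μneg (spaceTimeCylinder N T)ᶜ = 0
  singular : μpos.MutuallySingular μneg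
  pairing : ∀ φ : Space N × ℝ → ℝ, Continuous φ → HasCompactSupport φ →
    tsupport φ ⊆ spaceTimeCylinder N T →
    (∫ p, φ p ∂μpos) - (∫ p, φ p ∂μneg) =
      -(1 / (2 * r)) * ∫ p in spaceTimeCylinder N T,
        (∫ q, (φ (p.1 + q.1, p.2) - φ (p.1 + q.2, p.2)) ∂(z p))

/-- The existence of a generalised Cahn-Hoffman field `z` for the distance function `d` of `E`
such that `∂_t d ≥ Div^r z` outside `E`, up to the extinction time of `E`. -/
def HasCahnHoffmanField {N : ℕ} (r : ℝ) (E : Set (Space N × ℝ)) : Prop :=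
  ∃ (z : Space N × ℝ → Measure (Space N × Space N)) (μpos μneg : Measure (Space N × ℝ)),
    IsMeasureField r (extinctionTime E) z ∧
    IsNonlocalDivergence r (extinctionTime E) z μpos μneg ∧
    -- `∂_t d ≥ Div^r z` in `(ℝ^N × (0, T)) \ E`, where `∂_t d` is the distributional derivative
    LocallyIntegrableOn (distTo E) (spaceTimeCylinder N (extinctionTime E) \ E) volume ∧
    (∀ φ : Space N × ℝ → ℝ, ContDiff ℝ ∞ φ → HasCompactSupport φ →
      tsupport φ ⊆ spaceTimeCylinder N (extinctionTime E) \ E → (∀ p, 0 ≤ φ p) →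
      (∫ p, φ p ∂μpos) - (∫ p, φ p ∂μneg) ≤
        -∫ p, distTo E p * deriv (fun s => φ (p.1, s)) p.2) ∧
    -- `z` has mass at most one and attains the oscillation of `d`
    (∀ᵐ p ∂(volume.restrict (spaceTimeCylinder N (extinctionTime E))),
      z p (Cr N r) ≤ 1 ∧
      ∫ q, (distTo E (p.1 + q.1, p.2) - distTo E (p.1 + q.2, p.2)) ∂(z p) =
        essOsc (Metric.ball p.1 r) (fun x => distTo E (x, p.2))) ∧
    -- on `{d ≥ l}` the measure `(Div^r z)^+` has a bounded density
    (∀ l : ℝ, 0 < l → ∃ M : ℝ≥0,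
      μpos.restrict {p | p ∈ spaceTimeCylinder N (extinctionTime E) ∧ l ≤ distTo E p} ≤ M • volume)

/-- `E` is a weak superflow, with initial datum `E0`, of the Minkowski flow of scale `r`. -/
structure IsWeakSuperflow {N : ℕ} (r : ℝ) (E0 : Set (Space N)) (E : Set (Space N × ℝ)) :
    Prop where
  subset_halfSpace : E ⊆ halfSpace N
  closed : IsClosed E
  initial : slice E 0 ⊆ E0
  bounded : (∀ t, 0 ≤ t → Bornology.IsBounded (slice E t)) ∨
    (∀ t, 0 ≤ t → Bornology.IsBounded (slice E t)ᶜ)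
  right : ∀ t, 0 ≤ t → ∀ δ, 0 < δ → ∃ τ, 0 < τ ∧
    ∀ s ∈ Ioo t (t + τ), slice E s ⊆ Metric.thickening δ (slice E t)
  left : ∀ t, 0 < t → ∀ s : ℕ → ℝ, (∀ n, 0 ≤ s n ∧ s n < t) → Tendsto s atTop (𝓝 t) →
    KuratowskiTendsto (fun n => slice E (s n)) (slice E t)
  field : HasCahnHoffmanField r E

/-- `A` is a weak subflow, with initial datum `E0`, of the Minkowski flow of scale `r`: it is
relatively open in `ℝ^N × [0, ∞)`, and its complement in `ℝ^N × [0, ∞)` is a weak superflow with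
initial datum the complement of the interior of `E0`. -/
structure IsWeakSubflow {N : ℕ} (r : ℝ) (E0 : Set (Space N)) (A : Set (Space N × ℝ)) :
    Prop where
  relOpen : ∃ O : Set (Space N × ℝ), IsOpen O ∧ A = O ∩ halfSpace N
  compl : IsWeakSuperflow r (interior E0)ᶜ (halfSpace N \ A)

end MinkowskiFlow

/-!
Write `G` for the complement of `F`. Where they are bounded away from zero, both distances `d_E`
and `d_G` are supersolutions of `∂_t d ≥ Div^r z`, and initially `d_E + d_G ≥ Δ`. The inequality
is propagated by an energy argument. Near the sets nothing is known about `∂_t d`, so each distance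
is replaced by a soft maximum with a level growing at a rate `C` that bounds `(Div^r z)^+`; the two
truncations are again supersolutions. Let `u` be their sum and test both inequalities with
`φ = (Δ - u)^+`. Since `φ` is nonincreasing in `d_E` and in `d_G`, and `z` attains the oscillation
of the corresponding distance, it is carried by pairs `(x, y)` where that distance is maximal at
`w + x` and minimal at `w + y`. Adding the two pairings thus gives a favourable sign, and
`∫ (Δ - u)^2_+ / 2` does not increase. The distances are only left continuous in time; hence `φ` is
integrated over short time intervals before it is used as a test function.

At a midpoint of `x ∈ E(t)` and `y ∈ G(t)` both distances are at most `|x - y| / 2`, so `u ≥ Δ`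
forces `|x - y| ≥ Δ`. This holds on a short interval to the right of any time at which the sets are
separated, and Kuratowski continuity from the left closes the induction over time.
-/

open scoped Convolution

namespace MinkowskiFlow

section Integrability

variable {α : Type*} [MeasurableSpace α] {μ : Measure α} {d f : α → ℝ} {K : Set α} {B : ℝ}

theorem integrable_mul_of_support_subset (hd : IntegrableOn d K μ) (hf : AEStronglyMeasurable f μ)
    (hB : ∀ x, |f x| ≤ B) (hK : Function.support f ⊆ K) : Integrable (fun x => d x * f x) μ :=
  (integrableOn_iff_integrable_of_support_subset
    ((Function.support_mul_subset_right d f).trans hK)).1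
    (hd.mul_bdd (c := B) hf.restrict (Eventually.of_forall hB))

theorem tendsto_integral_mul_of_support_subset {g : ℕ → α → ℝ} (hKm : MeasurableSet K)
    (hd : IntegrableOn d K μ) (hg : ∀ n, AEStronglyMeasurable (g n) μ) (hB : ∀ n x, |g n x| ≤ B)
    (hK : ∀ n, Function.support (g n) ⊆ K)
    (hlim : ∀ᵐ x ∂μ, Tendsto (fun n => g n x) atTop (𝓝 (f x))) :
    Tendsto (fun n => ∫ x, d x * g n x ∂μ) atTop (𝓝 (∫ x, d x * f x ∂μ)) := by
  refine tendsto_integral_of_dominated_convergence (K.indicator fun x => |d x| * B)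
    (fun n => (integrable_mul_of_support_subset hd (hg n) (hB n) (hK n)).aestronglyMeasurable)
    ((integrable_indicator_iff hKm).2 (hd.abs.mul_const B))
    (fun n => Eventually.of_forall fun x => ?_) (hlim.mono fun x hx => hx.const_mul _)
  by_cases hx : x ∈ K
  · rw [indicator_of_mem hx, Real.norm_eq_abs, abs_mul]
    exact mul_le_mul_of_nonneg_left (hB n x) (abs_nonneg _)
  · rw [indicator_of_notMem hx, Function.notMem_support.1 fun h => hx (hK n h), mul_zero, norm_zero]

end Integrability

section ForwardIntegral

/-- The integral of `F` along the forward time segment of length `ε` issuing from a point of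
space-time; a smooth-in-time substitute for `ε • F` whose time derivative is a difference. -/
noncomputable def forwardIntegral {V : Type*} (ε : ℝ) (F : V × ℝ → ℝ) (p : V × ℝ) : ℝ :=
  ∫ t in p.2..p.2 + ε, F (p.1, t)

variable {V : Type*} {ε B : ℝ} {F G : V × ℝ → ℝ}

theorem forwardIntegral_nonneg (hε : 0 ≤ ε) (hF : ∀ p, 0 ≤ F p) (p : V × ℝ) :
    0 ≤ forwardIntegral ε F p :=
  intervalIntegral.integral_nonneg (by linarith) fun _ _ => hF _

theorem abs_forwardIntegral_le (hε : 0 ≤ ε) (hB : ∀ p, |F p| ≤ B) (p : V × ℝ) :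
    |forwardIntegral ε F p| ≤ B * ε := by
  simpa [abs_of_nonneg hε, forwardIntegral] using
    intervalIntegral.norm_integral_le_of_norm_le_const (a := p.2) (b := p.2 + ε) (C := B)
      (f := fun t => F (p.1, t)) fun t _ => hB _

theorem forwardIntegral_eq_integral_shift [AddMonoid V] (p : V × ℝ) :
    forwardIntegral ε F p = ∫ σ in (0 : ℝ)..ε, F (p + (0, σ)) := by
  have h := intervalIntegral.integral_comp_add_left (a := 0) (b := ε) (fun t => F (p.1, t)) p.2
  rw [add_zero] at h
  simp [forwardIntegral, ← h, Prod.add_def]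

theorem exists_of_forwardIntegral_ne_zero [AddMonoid V] (hε : 0 ≤ ε) {p : V × ℝ}
    (h : forwardIntegral ε F p ≠ 0) : ∃ σ ∈ Icc 0 ε, F (p + (0, σ)) ≠ 0 := by
  contrapose! h
  rw [forwardIntegral_eq_integral_shift,
    intervalIntegral.integral_congr (g := fun _ => 0) fun σ hσ =>
      h σ (by rwa [uIcc_of_le hε] at hσ),
    intervalIntegral.integral_zero]

theorem hasDerivAt_forwardIntegral [TopologicalSpace V] (hF : Continuous F) (x : V) (s : ℝ) :
    HasDerivAt (fun s => forwardIntegral ε F (x, s)) (F (x, s + ε) - F (x, s)) s := by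
  have hg : Continuous fun t => F (x, t) := by fun_prop
  have hi : ∀ a b, IntervalIntegrable (fun t => F (x, t)) volume a b := hg.intervalIntegrable
  have hprim : ∀ s, HasDerivAt (fun s => ∫ t in (0 : ℝ)..s, F (x, t)) (F (x, s)) s := fun s =>
    intervalIntegral.integral_hasDerivAt_right (hi _ _) (hg.stronglyMeasurableAtFilter _ _)
      hg.continuousAt
  refine (((hprim (s + ε)).comp_add_const s ε).sub (hprim s)).congr_of_eventuallyEq
    (Eventually.of_forall fun s => ?_)
  exact (intervalIntegral.integral_interval_sub_left (hi _ _) (hi _ _)).symm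

theorem forwardIntegral_add [MeasurableSpace V] (hF : Measurable F) (hG : Measurable G)
    (hFB : ∀ p, |F p| ≤ B) (hGB : ∀ p, |G p| ≤ B) (p : V × ℝ) :
    forwardIntegral ε (fun p => F p + G p) p = forwardIntegral ε F p + forwardIntegral ε G p := by
  have hi : ∀ {H : V × ℝ → ℝ}, Measurable H → (∀ p, |H p| ≤ B) →
      IntervalIntegrable (fun t => H (p.1, t)) volume p.2 (p.2 + ε) := fun hH hHB =>
    intervalIntegrable_iff.2 (IntegrableOn.of_bound (by simp [uIoc])
      (hH.comp measurable_prodMk_left).aestronglyMeasurable B (Eventually.of_forall fun t => hHB _))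
  exact intervalIntegral.integral_add (hi hF hFB) (hi hG hGB)

theorem continuous_forwardIntegral [TopologicalSpace V] [FirstCountableTopology V]
    [MeasurableSpace V] (hF : Measurable F) (hB : ∀ p, |F p| ≤ B)
    (hc : ∀ t, Continuous fun x => F (x, t)) : Continuous (forwardIntegral ε F) := by
  have hm : ∀ x, AEStronglyMeasurable (fun t => F (x, t)) := fun x =>
    (hF.comp measurable_prodMk_left).aestronglyMeasurable
  have hprim : Continuous fun p : V × ℝ => ∫ t in (0 : ℝ)..p.2, F (p.1, t) := by
    refine continuous_iff_continuousAt.2 fun ⟨x₀, s₀⟩ => ?_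
    refine intervalIntegral.continuousAt_parametric_primitive_of_dominated
      (F := fun x t => F (x, t)) (fun _ => B) (min 0 s₀ - 1) (max 0 s₀ + 1)
      (fun x => (hm x).restrict) (Eventually.of_forall fun x => Eventually.of_forall fun t => hB _)
      intervalIntegrable_const (Eventually.of_forall fun t => (hc t).continuousAt) ?_ ?_ (by simp)
    · constructor <;> linarith [min_le_left 0 s₀, le_max_left 0 s₀]
    · constructor <;> linarith [min_le_right 0 s₀, le_max_right 0 s₀]
  have hi : ∀ x a b, IntervalIntegrable (fun t => F (x, t)) volume a b := fun x a b =>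
    intervalIntegrable_iff.2 (IntegrableOn.of_bound (by simp [uIoc]) (hm x).restrict B
      (Eventually.of_forall fun t => hB _))
  have heq : forwardIntegral ε F = fun p : V × ℝ =>
      (∫ t in (0 : ℝ)..p.2 + ε, F (p.1, t)) - ∫ t in (0 : ℝ)..p.2, F (p.1, t) :=
    funext fun p => (intervalIntegral.integral_interval_sub_left (hi _ _ _) (hi _ _ _)).symm
  rw [heq]
  exact (hprim.comp (by fun_prop : Continuous fun p : V × ℝ => (p.1, p.2 + ε))).sub hprim

end ForwardIntegral

section Mollify

variable {E : Type*} [NormedAddCommGroup E]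

theorem exists_seq_contDiffBump {δ : ℝ} (hδ : 0 < δ) :
    ∃ ρ : ℕ → ContDiffBump (0 : E), (∀ n, (ρ n).rOut ≤ δ) ∧ (∀ n, (ρ n).rOut ≤ 2 * (ρ n).rIn) ∧
      Tendsto (fun n => (ρ n).rOut) atTop (𝓝 0) := by
  refine ⟨fun n => ⟨δ / (n + 1) / 2, δ / (n + 1), by positivity, half_lt_self (by positivity)⟩,
    fun n => div_le_self hδ.le (by simp), fun n => ?_, ?_⟩
  · simp only [mul_div_cancel₀ _ (two_ne_zero' ℝ), le_refl]
  · exact tendsto_const_nhds.div_atTop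
      (tendsto_atTop_add_const_right _ _ tendsto_natCast_atTop_atTop)

variable [NormedSpace ℝ E] [FiniteDimensional ℝ E] [MeasureSpace E]

/-- The mollification of `g` by a normalised bump function. -/
noncomputable def mollify (ρ : ContDiffBump (0 : E)) (g : E → ℝ) : E → ℝ :=
  ρ.normed volume ⋆[ContinuousLinearMap.lsmul ℝ ℝ, volume] g

variable {ρ : ContDiffBump (0 : E)} {g : E → ℝ} {p : E}

theorem mollify_nonneg (hg : ∀ q, 0 ≤ g q) : 0 ≤ mollify ρ g p :=
  integral_nonneg fun t => mul_nonneg (ρ.nonneg_normed t) (hg _)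

variable [BorelSpace E] [(volume : Measure E).IsAddHaarMeasure]

theorem exists_of_mollify_ne_zero (h : mollify ρ g p ≠ 0) :
    ∃ q, g q ≠ 0 ∧ dist p q < ρ.rOut := by
  obtain ⟨t, ht, q, hq, rfl⟩ := support_convolution_subset _ h
  rw [ρ.support_normed_eq] at ht
  exact ⟨q, hq, by simpa [dist_eq_norm] using ht⟩

theorem abs_mollify_le (hg : AEStronglyMeasurable g) {B : ℝ} (hB : ∀ q, |g q| ≤ B) :
    |mollify ρ g p| ≤ B := by
  simpa [mollify] using dist_convolution_le ((abs_nonneg _).trans (hB 0)) ρ.support_normed_eq.subset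
    ρ.nonneg_normed ρ.integral_normed hg (x₀ := p) (z₀ := 0) fun q _ => by simpa using hB q

theorem contDiff_mollify (hg : LocallyIntegrable g) : ContDiff ℝ ∞ (mollify ρ g) :=
  ρ.hasCompactSupport_normed.contDiff_convolution_left _ ρ.contDiff_normed hg

end Mollify

section SpaceTime

variable {V : Type*} [NormedAddCommGroup V] [NormedSpace ℝ V] [FiniteDimensional ℝ V]
  [MeasureSpace V] [BorelSpace V] [(volume : Measure V).IsAddHaarMeasure]
  {ε B : ℝ} {F : V × ℝ → ℝ}

instance isAddHaarMeasure_volume_spaceTime : (volume : Measure (V × ℝ)).IsAddHaarMeasure :=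
  inferInstanceAs ((volume : Measure V).prod (volume : Measure ℝ)).IsAddHaarMeasure

theorem integral_forwardIntegral (hF : Measurable F) (hi : Integrable F) :
    ∫ p, forwardIntegral ε F p = ε * ∫ p, F p := by
  have hshift : ∀ (H : V × ℝ → ℝ) (σ : ℝ), ∫ p, H (p + (0, σ)) = ∫ p, H p := fun H σ =>
    integral_add_right_eq_self H ((0 : V), σ)
  have hprod : Integrable (Function.uncurry fun σ (p : V × ℝ) => F (p + (0, σ)))
      ((volume.restrict (uIoc 0 ε)).prod volume) := by
    have hm : Measurable (Function.uncurry fun σ (p : V × ℝ) => F (p + (0, σ))) :=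
      hF.comp (by fun_prop)
    refine (integrable_prod_iff hm.aestronglyMeasurable).2
      ⟨Eventually.of_forall fun σ => hi.comp_add_right (0, σ), ?_⟩
    simp only [Function.uncurry_apply_pair, hshift fun p => ‖F p‖]
    exact integrableOn_const (by simp [uIoc])
  simp only [forwardIntegral_eq_integral_shift, ← intervalIntegral_integral_swap hprod, hshift F,
    intervalIntegral.integral_const, sub_zero, smul_eq_mul]

theorem mollify_forwardIntegral (ρ : ContDiffBump (0 : V × ℝ)) (hF : Measurable F)
    (hB : ∀ p, |F p| ≤ B) : mollify ρ (forwardIntegral ε F) = forwardIntegral ε (mollify ρ F) := by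
  funext p
  have hint : Integrable (Function.uncurry fun σ t => ρ.normed volume t * F (p + (0, σ) - t))
      ((volume.restrict (uIoc 0 ε)).prod volume) := by
    have hρ := Integrable.mul_prod (f := fun _ : ℝ => (1 : ℝ)) (μ := volume.restrict (uIoc 0 ε))
      (integrableOn_const (by simp [uIoc])) (ρ.integrable_normed (μ := volume))
    simp only [one_mul] at hρ
    exact hρ.mul_bdd (c := B) (hF.comp (by fun_prop)).aestronglyMeasurable
      (Eventually.of_forall fun q => hB _)
  simp only [mollify, convolution_def, forwardIntegral_eq_integral_shift,
    ContinuousLinearMap.lsmul_apply, smul_eq_mul]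
  rw [intervalIntegral_integral_swap hint]
  simp only [intervalIntegral.integral_const_mul, add_sub_right_comm]

end SpaceTime

section TimeSupersolution

variable {V : Type*} [NormedAddCommGroup V] [MeasureSpace V] {ε δ B : ℝ} {U K : Set (V × ℝ)}
  {F θ d : V × ℝ → ℝ} {μpos μneg ν : Measure (V × ℝ)}

/-- A nonnegative density to be averaged by `forwardIntegral ε`: it is bounded by `B`, continuous
in space but only measurable in time, and its support remains in `K` when it is moved backwards
in time by at most `ε`. -/
structure IsForwardTest (ε B : ℝ) (K : Set (V × ℝ)) (F : V × ℝ → ℝ) : Prop where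
  measurable : Measurable F
  nonneg : ∀ p, 0 ≤ F p
  le_bound : ∀ p, F p ≤ B
  continuous_slice : ∀ t, Continuous fun x => F (x, t)
  mem_of_ne_zero : ∀ p, ∀ σ ∈ Icc 0 ε, F (p + (0, σ)) ≠ 0 → p ∈ K

namespace IsForwardTest

theorem abs_le (h : IsForwardTest ε B K F) (p : V × ℝ) : |F p| ≤ B :=
  (abs_of_nonneg (h.nonneg p)).trans_le (h.le_bound p)

theorem support_subset (h : IsForwardTest ε B K F) (hε : 0 ≤ ε) : Function.support F ⊆ K :=
  fun p hp => h.mem_of_ne_zero p 0 ⟨le_rfl, hε⟩ (by simpa [Prod.mk_zero_zero] using hp)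

theorem support_shift_subset (h : IsForwardTest ε B K F) (hε : 0 ≤ ε) :
    (Function.support fun p => F (p + (0, ε))) ⊆ K :=
  fun p hp => h.mem_of_ne_zero p ε ⟨hε, le_rfl⟩ hp

theorem support_forwardIntegral_subset (h : IsForwardTest ε B K F) (hε : 0 ≤ ε) :
    Function.support (forwardIntegral ε F) ⊆ K := fun p hp =>
  let ⟨σ, hσ, hne⟩ := exists_of_forwardIntegral_ne_zero hε hp
  h.mem_of_ne_zero p σ hσ hne

theorem mul (h : IsForwardTest ε B K F) (hθ : Measurable θ) (h0 : ∀ p, 0 ≤ θ p)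
    (h1 : ∀ p, θ p ≤ 1) (hc : ∀ t, Continuous fun x => θ (x, t)) :
    IsForwardTest ε B K fun p => F p * θ p where
  measurable := h.measurable.mul hθ
  nonneg p := mul_nonneg (h.nonneg p) (h0 p)
  le_bound p := (mul_le_of_le_one_right (h.nonneg p) (h1 p)).trans (h.le_bound p)
  continuous_slice t := (h.continuous_slice t).mul (hc t)
  mem_of_ne_zero p σ hσ hp := h.mem_of_ne_zero p σ hσ (left_ne_zero_of_mul hp)

theorem continuous_forwardIntegral (h : IsForwardTest ε B K F) :
    Continuous (forwardIntegral ε F) :=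
  MinkowskiFlow.continuous_forwardIntegral h.measurable h.abs_le h.continuous_slice

theorem hasCompactSupport_forwardIntegral (h : IsForwardTest ε B K F) (hε : 0 ≤ ε)
    (hK : IsCompact K) : HasCompactSupport (forwardIntegral ε F) :=
  .intro' hK hK.isClosed fun _ hp => Function.notMem_support.1 fun hne =>
    hp (h.support_forwardIntegral_subset hε hne)

theorem integrable_mul (h : IsForwardTest ε B K F) (hε : 0 ≤ ε) (hd : IntegrableOn d K ν) :
    Integrable (fun p => d p * F p) ν :=
  integrable_mul_of_support_subset hd h.measurable.aestronglyMeasurable h.abs_le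
    (h.support_subset hε)

theorem integrable (h : IsForwardTest ε B K F) (hε : 0 ≤ ε) (hK : volume K < ⊤) :
    Integrable F := by
  simpa using h.integrable_mul hε (integrableOn_const (C := (1 : ℝ)) hK.ne)

variable [BorelSpace V]

theorem integrable_mul_shift (h : IsForwardTest ε B K F) (hε : 0 ≤ ε) (hd : IntegrableOn d K ν) :
    Integrable (fun p => d p * F (p + (0, ε))) ν :=
  integrable_mul_of_support_subset hd (h.measurable.comp (by fun_prop)).aestronglyMeasurable
    (fun p => h.abs_le _) (h.support_shift_subset hε)

theorem integrable_forwardIntegral (h : IsForwardTest ε B K F) (hε : 0 ≤ ε) (hK : ν K < ⊤) :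
    Integrable (forwardIntegral ε F) ν := by
  simpa using integrable_mul_of_support_subset (integrableOn_const (C := (1 : ℝ)) hK.ne)
    h.continuous_forwardIntegral.aestronglyMeasurable (abs_forwardIntegral_le hε h.abs_le)
    (h.support_forwardIntegral_subset hε)

variable [NormedSpace ℝ V] [FiniteDimensional ℝ V] [(volume : Measure V).IsAddHaarMeasure]

theorem integrable_mul_difference (h : IsForwardTest ε B K F) (hε : 0 ≤ ε)
    (hd : IntegrableOn d K) : Integrable fun p => F p * (d p - d (p - (0, ε))) := by
  have hshift := (h.integrable_mul_shift hε hd).comp_sub_right ((0 : V), ε)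
  refine ((h.integrable_mul hε hd).sub hshift).congr (Eventually.of_forall fun p => ?_)
  simp only [Pi.sub_apply, sub_add_cancel]
  ring

theorem integral_mul_difference (h : IsForwardTest ε B K F) (hε : 0 ≤ ε) (hd : IntegrableOn d K) :
    ∫ p, F p * (d p - d (p - (0, ε))) = (∫ p, d p * F p) - ∫ p, d p * F (p + (0, ε)) := by
  have hshift := (h.integrable_mul_shift hε hd).comp_sub_right ((0 : V), ε)
  rw [← integral_sub_right_eq_self (fun p => d p * F (p + (0, ε))) ((0 : V), ε),
    ← integral_sub (h.integrable_mul hε hd) hshift]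
  refine integral_congr_ae (Eventually.of_forall fun p => ?_)
  simp only [sub_add_cancel]
  ring

theorem mollify (h : IsForwardTest ε B K F) (hF : LocallyIntegrable F)
    {ρ : ContDiffBump (0 : V × ℝ)} (hρ : ρ.rOut ≤ δ) :
    IsForwardTest ε B (Metric.cthickening δ K) (mollify ρ F) where
  measurable := (contDiff_mollify hF).continuous.measurable
  nonneg _ := mollify_nonneg h.nonneg
  le_bound _ := (le_abs_self _).trans (abs_mollify_le h.measurable.aestronglyMeasurable h.abs_le)
  continuous_slice _ := (contDiff_mollify hF).continuous.comp (by fun_prop)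
  mem_of_ne_zero p σ hσ hp := by
    obtain ⟨q, hq, hpq⟩ := exists_of_mollify_ne_zero hp
    refine Metric.mem_cthickening_of_dist_le p (q - (0, σ)) δ K
      (h.mem_of_ne_zero _ σ hσ (by simpa using hq)) (le_trans (le_of_eq ?_) (hpq.le.trans hρ))
    rw [dist_eq_norm, dist_eq_norm, sub_sub_eq_add_sub]

end IsForwardTest

/-- `d` satisfies `∂ₜ d ≥ μpos - μneg` in `U` in the sense of distributions, where `μpos` and `μneg`
are finite on the compact subsets of `U`. -/
structure IsTimeSupersolution [NormedSpace ℝ V] (U : Set (V × ℝ)) (d : V × ℝ → ℝ)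
    (μpos μneg : Measure (V × ℝ)) : Prop where
  integrableOn : ∀ K, IsCompact K → K ⊆ U → IntegrableOn d K
  pos_lt_top : ∀ K, IsCompact K → K ⊆ U → μpos K < ⊤
  neg_lt_top : ∀ K, IsCompact K → K ⊆ U → μneg K < ⊤
  pairing_le : ∀ φ : V × ℝ → ℝ, ContDiff ℝ ∞ φ → HasCompactSupport φ → tsupport φ ⊆ U →
    (∀ p, 0 ≤ φ p) → (∫ p, φ p ∂μpos) - (∫ p, φ p ∂μneg) ≤
      -∫ p, d p * deriv (fun s => φ (p.1, s)) p.2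

namespace IsTimeSupersolution

variable [NormedSpace ℝ V] [BorelSpace V]

theorem pairing_forwardIntegral_le_of_contDiff (h : IsTimeSupersolution U d μpos μneg)
    (hε : 0 ≤ ε) (hK : IsCompact K) (hKU : K ⊆ U) (hF : IsForwardTest ε B K F)
    (hFc : Continuous F) (hAF : ContDiff ℝ ∞ (forwardIntegral ε F)) :
    (∫ p, forwardIntegral ε F p ∂μpos) - (∫ p, forwardIntegral ε F p ∂μneg) ≤
      (∫ p, d p * F p) - ∫ p, d p * F (p + (0, ε)) := by
  have hd := h.integrableOn K hK hKU
  refine (h.pairing_le _ hAF (hF.hasCompactSupport_forwardIntegral hε hK)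
    ((closure_minimal (hF.support_forwardIntegral_subset hε) hK.isClosed).trans hKU)
    (forwardIntegral_nonneg hε hF.nonneg)).trans_eq ?_
  rw [← integral_sub (hF.integrable_mul hε hd) (hF.integrable_mul_shift hε hd), ← integral_neg]
  refine integral_congr_ae (Eventually.of_forall fun p => ?_)
  simp only [(hasDerivAt_forwardIntegral hFc p.1 p.2).deriv, Prod.add_def, add_zero]
  ring

variable [FiniteDimensional ℝ V] [(volume : Measure V).IsAddHaarMeasure]

theorem pairing_forwardIntegral_le (h : IsTimeSupersolution U d μpos μneg) (hU : IsOpen U)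
    (hε : 0 ≤ ε) (hK : IsCompact K) (hKU : K ⊆ U) (hF : IsForwardTest ε B K F) :
    (∫ p, forwardIntegral ε F p ∂μpos) - (∫ p, forwardIntegral ε F p ∂μneg) ≤
      ∫ p, F p * (d p - d (p - (0, ε))) := by
  obtain ⟨δ, hδ, hδU⟩ := hK.exists_cthickening_subset_open hU hKU
  have hKδ : IsCompact (Metric.cthickening δ K) := hK.cthickening
  obtain ⟨ρ, hρδ, hρ2, hρ0⟩ := exists_seq_contDiffBump (E := V × ℝ) hδ
  have hFi := (hF.integrable hε hK.measure_lt_top).locallyIntegrable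
  have hAF := hF.continuous_forwardIntegral
  have hFρ : ∀ n, IsForwardTest ε B (Metric.cthickening δ K) (mollify (ρ n) F) := fun n =>
    hF.mollify hFi (hρδ n)
  have hcomm : ∀ n, mollify (ρ n) (forwardIntegral ε F) = forwardIntegral ε (mollify (ρ n) F) :=
    fun n => mollify_forwardIntegral (ρ n) hF.measurable hF.abs_le
  have hAFlim : ∀ p, Tendsto (fun n => forwardIntegral ε (mollify (ρ n) F) p) atTop
      (𝓝 (forwardIntegral ε F p)) := fun p => by
    simp only [← hcomm]
    exact ContDiffBump.convolution_tendsto_right_of_continuous hρ0 hAF p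
  have hFlim : ∀ᵐ p : V × ℝ, Tendsto (fun n => mollify (ρ n) F p) atTop (𝓝 (F p)) :=
    ContDiffBump.ae_convolution_tendsto_right_of_locallyIntegrable hρ0
      (Eventually.of_forall hρ2) hFi
  have hFlim_shift := (measurePreserving_add_right volume ((0 : V), ε)).quasiMeasurePreserving.ae
    hFlim
  have hAlim : ∀ ν : Measure (V × ℝ), ν (Metric.cthickening δ K) < ⊤ →
      Tendsto (fun n => ∫ p, forwardIntegral ε (mollify (ρ n) F) p ∂ν) atTop
        (𝓝 (∫ p, forwardIntegral ε F p ∂ν)) := fun ν hν => by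
    simpa using tendsto_integral_mul_of_support_subset hKδ.measurableSet
      (integrableOn_const (C := (1 : ℝ)) hν.ne)
      (fun n => (hFρ n).continuous_forwardIntegral.aestronglyMeasurable)
      (fun n => abs_forwardIntegral_le hε (hFρ n).abs_le)
      (fun n => (hFρ n).support_forwardIntegral_subset hε) (Eventually.of_forall hAFlim)
  have hd := h.integrableOn _ hKδ hδU
  have hdlim := tendsto_integral_mul_of_support_subset hKδ.measurableSet hd
    (fun n => (hFρ n).measurable.aestronglyMeasurable) (fun n => (hFρ n).abs_le)
    (fun n => (hFρ n).support_subset hε) hFlim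
  have hdlim_shift := tendsto_integral_mul_of_support_subset hKδ.measurableSet hd
    (fun n => ((hFρ n).measurable.comp (by fun_prop)).aestronglyMeasurable)
    (fun n p => (hFρ n).abs_le _) (fun n => (hFρ n).support_shift_subset hε) hFlim_shift
  rw [hF.integral_mul_difference hε (h.integrableOn K hK hKU)]
  refine le_of_tendsto_of_tendsto' ((hAlim μpos (h.pos_lt_top _ hKδ hδU)).sub
    (hAlim μneg (h.neg_lt_top _ hKδ hδU))) (hdlim.sub hdlim_shift) fun n => ?_
  exact h.pairing_forwardIntegral_le_of_contDiff hε hKδ hδU (hFρ n)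
    (contDiff_mollify hFi).continuous (hcomm n ▸ contDiff_mollify hAF.locallyIntegrable)

/-- The inequality `∂ₜ d ≥ μpos - μneg` is used on the part `θ` of the density, while on the part
`1 - θ` only the bound on `μpos` is used. -/
theorem pairing_forwardIntegral_le_of_restrict_le (h : IsTimeSupersolution U d μpos μneg)
    {C : ℝ≥0} (hC : μpos.restrict U ≤ C • volume) (hU : IsOpen U)
    (hε : 0 ≤ ε) (hK : IsCompact K) (hKU : K ⊆ U) (hF : IsForwardTest ε B K F)
    (hθ : Measurable θ) (h0 : ∀ p, 0 ≤ θ p) (h1 : ∀ p, θ p ≤ 1)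
    (hc : ∀ t, Continuous fun x => θ (x, t)) :
    Integrable (fun p => F p * (C * ε * (1 - θ p) + θ p * (d p - d (p - (0, ε))))) ∧
    (∫ p, forwardIntegral ε F p ∂μpos) - (∫ p, forwardIntegral ε F p ∂μneg) ≤
      ∫ p, F p * (C * ε * (1 - θ p) + θ p * (d p - d (p - (0, ε)))) := by
  have hG := hF.mul hθ h0 h1 hc
  have hH : IsForwardTest ε B K fun p => F p * (1 - θ p) := hF.mul (measurable_const.sub hθ)
    (fun p => sub_nonneg.2 (h1 p)) (fun p => sub_le_self 1 (h0 p))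
    fun t => continuous_const.sub (hc t)
  have hsplit : forwardIntegral ε F = fun p => forwardIntegral ε (fun p => F p * θ p) p +
      forwardIntegral ε (fun p => F p * (1 - θ p)) p := funext fun p => by
    rw [← forwardIntegral_add hG.measurable hH.measurable hG.abs_le hH.abs_le]
    simp only [mul_sub, mul_one, add_sub_cancel]
  have hneg : 0 ≤ ∫ p, forwardIntegral ε (fun p => F p * (1 - θ p)) p ∂μneg :=
    integral_nonneg (forwardIntegral_nonneg hε hH.nonneg)
  have hpos : ∫ p, forwardIntegral ε (fun p => F p * (1 - θ p)) p ∂μpos ≤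
      C * (ε * ∫ p, F p * (1 - θ p)) := by
    rw [← integral_forwardIntegral hH.measurable (hH.integrable hε hK.measure_lt_top),
      ← setIntegral_eq_integral_of_forall_compl_eq_zero fun p hp => Function.notMem_support.1
        fun hne => hp (hKU (hH.support_forwardIntegral_subset hε hne))]
    exact (integral_mono_measure hC (Eventually.of_forall (forwardIntegral_nonneg hε hH.nonneg))
      (hH.integrable_forwardIntegral hε hK.measure_lt_top).smul_measure_nnreal).trans_eq
      (integral_smul_nnreal_measure _ C)
  have hadd : ∀ {ν : Measure (V × ℝ)}, ν K < ⊤ → ∫ p, forwardIntegral ε F p ∂ν =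
      (∫ p, forwardIntegral ε (fun p => F p * θ p) p ∂ν) +
        ∫ p, forwardIntegral ε (fun p => F p * (1 - θ p)) p ∂ν := fun hν => by
    rw [hsplit, integral_add (hG.integrable_forwardIntegral hε hν)
      (hH.integrable_forwardIntegral hε hν)]
  have hweak := h.pairing_forwardIntegral_le hU hε hK hKU hG
  have hHi := (hH.integrable hε hK.measure_lt_top).const_mul (C * ε)
  have hGi := hG.integrable_mul_difference hε (h.integrableOn K hK hKU)
  have heq : (fun p => F p * (C * ε * (1 - θ p) + θ p * (d p - d (p - (0, ε))))) =
      fun p => C * ε * (F p * (1 - θ p)) + F p * θ p * (d p - d (p - (0, ε))) :=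
    funext fun p => by ring
  rw [heq, integral_add hHi hGi, integral_const_mul, hadd (h.pos_lt_top K hK hKU),
    hadd (h.neg_lt_top K hK hKU)]
  exact ⟨hHi.add hGi, by linarith⟩

end IsTimeSupersolution

end TimeSupersolution

theorem aemeasurable_integral_of_continuous {α Q : Type*} [TopologicalSpace α]
    [SecondCountableTopology α] [TopologicalSpace.PseudoMetrizableSpace α] [MeasurableSpace α]
    [BorelSpace α] [TopologicalSpace Q] [MeasurableSpace Q] [OpensMeasurableSpace Q]
    {ν : Measure α} {z : α → Measure Q} {B : ℝ}
    (hz : ∀ f : Q → ℝ, Continuous f → AEMeasurable (fun p => ∫ q, f q ∂(z p)) ν)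
    (hfin : ∀ᵐ p ∂ν, IsFiniteMeasure (z p)) {f : α → Q → ℝ} (hB : ∀ p q, |f p q| ≤ B)
    (hp : ∀ q, Continuous fun p => f p q) (hq : ∀ p, Continuous (f p)) :
    AEMeasurable (fun p => ∫ q, f p q ∂(z p)) ν := by
  have hid : StronglyMeasurable (id : α → α) := measurable_id.stronglyMeasurable
  refine aemeasurable_of_tendsto_metrizable_ae (u := atTop)
    (f := fun n p => ∫ q, f (hid.approx n p) q ∂(z p)) (fun n => ?_) ?_
  · have heq : (fun p => ∫ q, f (hid.approx n p) q ∂(z p)) = fun p =>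
        ∑ c ∈ (hid.approx n).range,
          (hid.approx n ⁻¹' {c}).indicator (fun p => ∫ q, f c q ∂(z p)) p := by
      funext p
      rw [Finset.sum_eq_single (hid.approx n p), indicator_of_mem (by exact rfl)]
      · refine fun c _ hc => indicator_of_notMem ?_ _
        exact fun h => hc h.symm
      · exact fun h => absurd (SimpleFunc.mem_range_self _ _) h
    rw [heq]
    exact Finset.aemeasurable_fun_sum _ fun c _ =>
      (hz _ (hq c)).indicator ((hid.approx n).measurableSet_preimage _)
  · filter_upwards [hfin] with p _
    exact tendsto_integral_of_dominated_convergence (fun _ => B)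
      (fun n => (hq _).aestronglyMeasurable) (integrable_const _)
      (fun n => Eventually.of_forall fun q => hB _ q)
      (Eventually.of_forall fun q => ((hp q).tendsto p).comp (hid.tendsto_approx p))

section Lebesgue

variable {V : Type*} [MeasurableSpace V] {B ε : ℝ} {L : ℝ≥0}
  {F : V × ℝ → ℝ}

theorem locallyIntegrable_section (hF : Measurable F) (hB : ∀ p, |F p| ≤ B) (x : V) :
    LocallyIntegrable fun t => F (x, t) :=
  (locallyIntegrable_const B).mono (hF.comp measurable_prodMk_left).aestronglyMeasurable
    (Eventually.of_forall fun t => (hB (x, t)).trans (le_abs_self B))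

theorem intervalIntegrable_section (hF : Measurable F) (hB : ∀ p, |F p| ≤ B) (x : V) (s t : ℝ) :
    IntervalIntegrable (fun t => F (x, t)) volume s t :=
  intervalIntegrable_iff.2 <| ((locallyIntegrable_section hF hB x).integrableOn_isCompact
    isCompact_uIcc).mono_set uIoc_subset_uIcc

variable [PseudoMetricSpace V]

theorem lipschitzWith_forwardIntegral_div (hF : Measurable F) (hB : ∀ p, |F p| ≤ B)
    (hL : ∀ t, LipschitzWith L fun x => F (x, t)) (hε : 0 < ε) (s : ℝ) :
    LipschitzWith L fun x => forwardIntegral ε F (x, s) / ε := by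
  refine LipschitzWith.of_dist_le_mul fun x y => ?_
  have hxy := intervalIntegral.norm_integral_le_of_norm_le_const (a := s) (b := s + ε)
    (C := L * dist x y) (f := fun t => F (x, t) - F (y, t)) fun t _ => (hL t).dist_le_mul x y
  rw [intervalIntegral.integral_sub (intervalIntegrable_section hF hB x _ _)
    (intervalIntegrable_section hF hB y _ _), add_sub_cancel_left, abs_of_pos hε] at hxy
  rwa [Real.dist_eq, ← sub_div, abs_div, abs_of_pos hε, div_le_iff₀ hε]

theorem ae_tendsto_forwardIntegral_div [SecondCountableTopology V] (hF : Measurable F)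
    (hB : ∀ p, |F p| ≤ B) (hL : ∀ t, LipschitzWith L fun x => F (x, t)) {ε : ℕ → ℝ}
    (hε : ∀ n, 0 < ε n) (hlim : Tendsto ε atTop (𝓝 0)) :
    ∀ᵐ s : ℝ, ∀ x,
      Tendsto (fun n => forwardIntegral (ε n) F (x, s) / ε n) atTop (𝓝 (F (x, s))) := by
  obtain ⟨D, hDc, hD⟩ := TopologicalSpace.exists_countable_dense V
  have hae : ∀ᵐ s : ℝ, ∀ x ∈ D, ∀ c, HasDerivAt (fun s => ∫ t in c..s, F (x, t)) (F (x, s)) s :=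
    (ae_ball_iff hDc).2 fun x _ => LocallyIntegrable.ae_hasDerivAt_integral
      (locallyIntegrable_section hF hB x)
  filter_upwards [hae] with s hs x
  have hequi := (LipschitzWith.uniformEquicontinuous _ L fun n =>
    lipschitzWith_forwardIntegral_div hF hB hL (hε n) s).equicontinuous x
  refine hequi.tendsto_of_mem_closure ((hL s).continuous.continuousWithinAt (s := D))
    (fun y hy => ?_) (hD x)
  refine ((hs y hy s).tendsto_slope_zero_right.comp
    (tendsto_nhdsWithin_iff.2 ⟨hlim, Eventually.of_forall hε⟩)).congr fun n => ?_
  simp only [Function.comp_apply, intervalIntegral.integral_same, sub_zero, smul_eq_mul,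
    forwardIntegral, div_eq_inv_mul]

end Lebesgue

section EssSup

variable {X β : Type*} [TopologicalSpace X] [MeasurableSpace X] [OpensMeasurableSpace X]
  {μ : Measure X} [μ.IsOpenPosMeasure] [ConditionallyCompleteLinearOrder β] [TopologicalSpace β]
  [OrderTopology β] [SecondCountableTopology β] {s : Set X} {v : X → β} {x : X}

theorem le_essSup_of_mem_closure (hs : IsOpen s) (hv : Continuous v) (hb : BddAbove (v '' s))
    (hx : x ∈ closure s) : v x ≤ essSup v (μ.restrict s) := by
  by_contra! hlt
  obtain ⟨M, hM⟩ := hb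
  have hbdd : IsBoundedUnder (· ≤ ·) (ae (μ.restrict s)) v :=
    ⟨M, eventually_map.2 <| (ae_restrict_mem hs.measurableSet).mono fun y hy =>
      hM (mem_image_of_mem v hy)⟩
  have hnull : μ ({y | essSup v (μ.restrict s) < v y} ∩ s) = 0 := by
    rw [← Measure.restrict_apply' hs.measurableSet]
    exact (ae_iff.1 (ae_le_essSup hbdd)).symm ▸ by simp only [not_le]
  have hopen : IsOpen {y | essSup v (μ.restrict s) < v y} := isOpen_lt continuous_const hv
  exact ((hopen.inter hs).measure_pos μ (mem_closure_iff.1 hx _ hopen hlt)).ne' hnull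

theorem essInf_le_of_mem_closure (hs : IsOpen s) (hv : Continuous v) (hb : BddBelow (v '' s))
    (hx : x ∈ closure s) : essInf v (μ.restrict s) ≤ v x :=
  le_essSup_of_mem_closure (β := βᵒᵈ) hs hv hb hx

end EssSup

theorem integrable_of_continuous_of_compl_null {X E : Type*} [TopologicalSpace X]
    [MeasurableSpace X] [OpensMeasurableSpace X] [T2Space X] [NormedAddCommGroup E]
    {ζ : Measure X} [IsFiniteMeasureOnCompacts ζ] {K : Set X}
    (hK : IsCompact K) (hζ : ζ Kᶜ = 0) {h : X → E} (hh : Continuous h) : Integrable h ζ := by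
  have hi := hh.continuousOn.integrableOn_compact (μ := ζ) hK
  rwa [IntegrableOn, Measure.restrict_eq_self_of_ae_mem hζ] at hi

/-- The integral of the differences of `φ` around `w` against the measure `ζ`; the nonlocal
divergence is dual to it. -/
noncomputable def diffPairing {V : Type*} [Add V] [MeasurableSpace V] (φ : V → ℝ) (w : V)
    (ζ : Measure (V × V)) : ℝ :=
  ∫ q, (φ (w + q.1) - φ (w + q.2)) ∂ζ

theorem diffPairing_div {V : Type*} [Add V] [MeasurableSpace V] (φ : V → ℝ) (w : V)
    (ζ : Measure (V × V)) (c : ℝ) :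
    diffPairing (fun x => φ x / c) w ζ = diffPairing φ w ζ / c := by
  simp only [diffPairing, ← integral_div, sub_div]

variable {N : ℕ} {r : ℝ}

/-- A measure on `C_r` of mass at most one, as the values of a Cahn-Hoffman field are. -/
structure IsSubprobabilityOn (r : ℝ) (ζ : Measure (Space N × Space N)) : Prop where
  univ_le_one : ζ univ ≤ 1
  compl_Cr : ζ (Cr N r)ᶜ = 0

namespace IsSubprobabilityOn

variable {ζ : Measure (Space N × Space N)} {φ : Space N → ℝ} {w : Space N} {B : ℝ}

theorem isFiniteMeasure (h : IsSubprobabilityOn r ζ) : IsFiniteMeasure ζ :=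
  ⟨h.univ_le_one.trans_lt ENNReal.one_lt_top⟩

theorem real_univ_le_one (h : IsSubprobabilityOn r ζ) : ζ.real univ ≤ 1 :=
  ENNReal.toReal_le_of_le_ofReal zero_le_one (h.univ_le_one.trans_eq ENNReal.ofReal_one.symm)

theorem ae_mem_closedBall (h : IsSubprobabilityOn r ζ) (w : Space N) :
    ∀ᵐ q ∂ζ, w + q.1 ∈ Metric.closedBall w r ∧ w + q.2 ∈ Metric.closedBall w r := by
  have hmem : ∀ᵐ q ∂ζ, q ∈ Cr N r := h.compl_Cr
  filter_upwards [hmem] with q hq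
  simpa [Cr] using hq

theorem integrable_difference (h : IsSubprobabilityOn r ζ) (hφ : Continuous φ) (w : Space N) :
    Integrable (fun q => φ (w + q.1) - φ (w + q.2)) ζ :=
  have := h.isFiniteMeasure
  integrable_of_continuous_of_compl_null
    ((isCompact_closedBall _ _).prod (isCompact_closedBall _ _)) h.compl_Cr (by fun_prop)

theorem diffPairing_le (h : IsSubprobabilityOn r ζ) (hφ : Continuous φ) {c : ℝ}
    (hc : ∀ᵐ q ∂ζ, φ (w + q.1) - φ (w + q.2) ≤ c) : diffPairing φ w ζ ≤ c * ζ.real univ := by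
  have := h.isFiniteMeasure
  refine (integral_mono_ae (h.integrable_difference hφ w) (integrable_const c) hc).trans_eq ?_
  rw [integral_const, smul_eq_mul, mul_comm]

theorem abs_diffPairing_le (h : IsSubprobabilityOn r ζ) {K : Set (Space N)} (hB : ∀ x, |φ x| ≤ B)
    (hφ : ∀ x, φ x ≠ 0 → x ∈ K) :
    |diffPairing φ w ζ| ≤ (Metric.cthickening r K).indicator (fun _ => 2 * B) w := by
  have := h.isFiniteMeasure
  by_cases hw : w ∈ Metric.cthickening r K
  · rw [indicator_of_mem hw]
    have hB0 : 0 ≤ B := (abs_nonneg _).trans (hB w)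
    have hle : |diffPairing φ w ζ| ≤ 2 * B * ζ.real univ :=
      norm_integral_le_of_norm_le_const (f := fun q : Space N × Space N =>
        φ (w + q.1) - φ (w + q.2)) (Eventually.of_forall fun _ =>
        (abs_sub _ _).trans ((add_le_add (hB _) (hB _)).trans_eq (two_mul B).symm))
    exact hle.trans (mul_le_of_le_one_right (by positivity) h.real_univ_le_one)
  · rw [indicator_of_notMem hw]
    have hzero : ∀ x ∈ Metric.closedBall w r, φ x = 0 := fun x hx => by
      by_contra hne
      exact hw (Metric.mem_cthickening_of_dist_le w x r K (hφ x hne) (Metric.mem_closedBall'.1 hx))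
    refine (abs_eq_zero.2 (integral_eq_zero_of_ae ?_)).le
    filter_upwards [h.ae_mem_closedBall w] with q hq
    simp only [hzero _ hq.1, hzero _ hq.2, sub_zero, Pi.zero_apply]

theorem tendsto_diffPairing (h : IsSubprobabilityOn r ζ) {φ : ℕ → Space N → ℝ}
    {φ' : Space N → ℝ} (hc : ∀ n, Continuous (φ n)) (hB : ∀ n x, |φ n x| ≤ B)
    (hlim : ∀ x, Tendsto (fun n => φ n x) atTop (𝓝 (φ' x))) :
    Tendsto (fun n => diffPairing (φ n) w ζ) atTop (𝓝 (diffPairing φ' w ζ)) :=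
  have := h.isFiniteMeasure
  tendsto_integral_of_dominated_convergence (fun _ => B + B)
    (fun n => (h.integrable_difference (hc n) w).aestronglyMeasurable) (integrable_const _)
    (fun n => Eventually.of_forall fun _ => (abs_sub _ _).trans (add_le_add (hB n _) (hB n _)))
    (Eventually.of_forall fun _ => (hlim _).sub (hlim _))

end IsSubprobabilityOn

/-- The measure `ζ` transports between extremal points of `v` on the ball of radius `r` around `w`,
where `S` is the maximum of `v` and `I` its minimum, and has full mass unless `v` is constant
there. -/
structure IsExtremal (r : ℝ) (v : Space N → ℝ) (w : Space N) (ζ : Measure (Space N × Space N))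
    (S I : ℝ) : Prop extends IsSubprobabilityOn r ζ where
  le : I ≤ S
  mem_Icc : ∀ x ∈ Metric.closedBall w r, v x ∈ Icc I S
  ae_eq : ∀ᵐ q ∂ζ, v (w + q.1) = S ∧ v (w + q.2) = I
  eq_or_real_univ_eq_one : I = S ∨ ζ.real univ = 1

theorem IsSubprobabilityOn.isExtremal (hr : 0 < r) {v : Space N → ℝ} (hv : Continuous v)
    {w : Space N} {ζ : Measure (Space N × Space N)} (h : IsSubprobabilityOn r ζ)
    (hosc : diffPairing v w ζ = essOsc (Metric.ball w r) v) :
    IsExtremal r v w ζ (essSup v (volume.restrict (Metric.ball w r)))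
      (essInf v (volume.restrict (Metric.ball w r))) := by
  have := h.isFiniteMeasure
  have hbdd := (isCompact_closedBall w r).image hv
  have hball := image_mono (f := v) (Metric.ball_subset_closedBall (x := w) (ε := r))
  have hmem : ∀ x ∈ Metric.closedBall w r, v x ∈
      Icc (essInf v (volume.restrict (Metric.ball w r)))
        (essSup v (volume.restrict (Metric.ball w r))) := fun x hx => by
    rw [← closure_ball w hr.ne'] at hx
    exact ⟨essInf_le_of_mem_closure Metric.isOpen_ball hv (hbdd.bddBelow.mono hball) hx,
      le_essSup_of_mem_closure Metric.isOpen_ball hv (hbdd.bddAbove.mono hball) hx⟩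
  have hcentre := hmem w (Metric.mem_closedBall_self hr.le)
  have hint := (integrable_const (essOsc (Metric.ball w r) v)).sub (h.integrable_difference hv w)
  have hnonneg : 0 ≤ᵐ[ζ] fun q => essOsc (Metric.ball w r) v - (v (w + q.1) - v (w + q.2)) := by
    filter_upwards [h.ae_mem_closedBall w] with q hq
    exact sub_nonneg.2 (sub_le_sub (hmem _ hq.1).2 (hmem _ hq.2).1)
  have hval : ∫ q, (essOsc (Metric.ball w r) v - (v (w + q.1) - v (w + q.2))) ∂ζ =
      essOsc (Metric.ball w r) v * (ζ.real univ - 1) := by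
    rw [integral_sub (integrable_const _) (h.integrable_difference hv w), integral_const,
      show ∫ q, (v (w + q.1) - v (w + q.2)) ∂ζ = essOsc (Metric.ball w r) v from hosc, smul_eq_mul]
    ring
  have hzero : essOsc (Metric.ball w r) v * (ζ.real univ - 1) = 0 :=
    le_antisymm (mul_nonpos_of_nonneg_of_nonpos (sub_nonneg.2 (hcentre.1.trans hcentre.2))
      (sub_nonpos.2 h.real_univ_le_one)) (hval ▸ integral_nonneg_of_ae hnonneg)
  refine ⟨h, hcentre.1.trans hcentre.2, hmem, ?_, ?_⟩
  · filter_upwards [(integral_eq_zero_iff_of_nonneg_ae hnonneg hint).1 (hval.trans hzero),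
      h.ae_mem_closedBall w] with q hq hqw
    have h1 := (hmem _ hqw.1).2
    have h2 := (hmem _ hqw.2).1
    simp only [essOsc, Pi.zero_apply] at hq
    constructor <;> linarith
  · exact (mul_eq_zero.1 hzero).imp (fun h0 => (sub_eq_zero.1 h0).symm) sub_eq_zero.1

section Monotonicity

variable {a b : Space N → ℝ} {w : Space N} {ζ ζ₁ ζ₂ : Measure (Space N × Space N)}
  {S I S₁ I₁ S₂ I₂ : ℝ} {γ : ℝ → ℝ → ℝ}

theorem IsExtremal.diffPairing_le (h : IsExtremal r a w ζ S I)
    (hb : ∀ x ∈ Metric.closedBall w r, b x ∈ Icc I₂ S₂) (hγ : ∀ x, Antitone (γ x))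
    (hc : Continuous fun x => γ (a x) (b x)) :
    diffPairing (fun x => γ (a x) (b x)) w ζ ≤ (γ S I₂ - γ I S₂) * ζ.real univ := by
  refine h.toIsSubprobabilityOn.diffPairing_le hc ?_
  filter_upwards [h.ae_eq, h.ae_mem_closedBall w] with q hq hqw
  rw [hq.1, hq.2]
  exact sub_le_sub (hγ S (hb _ hqw.1).1) (hγ I (hb _ hqw.2).2)

theorem IsExtremal.diffPairing_add_nonpos (h₁ : IsExtremal r a w ζ₁ S₁ I₁)
    (h₂ : IsExtremal r b w ζ₂ S₂ I₂) (hγ₁ : ∀ y, Antitone fun x => γ x y)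
    (hγ₂ : ∀ x, Antitone (γ x)) (hc : Continuous fun x => γ (a x) (b x)) :
    diffPairing (fun x => γ (a x) (b x)) w ζ₁ + diffPairing (fun x => γ (a x) (b x)) w ζ₂ ≤ 0 := by
  have hle₁ := h₁.diffPairing_le h₂.mem_Icc hγ₂ hc
  have hle₂ := h₂.diffPairing_le (γ := fun y x => γ x y) h₁.mem_Icc hγ₁ hc
  have hI : I₁ = S₁ → 0 ≤ γ S₁ I₂ - γ I₁ S₂ := fun he => by
    rw [he]
    exact sub_nonneg.2 (hγ₂ S₁ h₂.le)
  have hS : I₂ = S₂ → γ S₁ I₂ - γ I₁ S₂ ≤ 0 := fun he => by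
    rw [he]
    exact sub_nonpos.2 (hγ₁ S₂ h₁.le)
  have hmass : (γ S₁ I₂ - γ I₁ S₂) * (ζ₁.real univ - ζ₂.real univ) ≤ 0 := by
    rcases h₁.eq_or_real_univ_eq_one with e₁ | m₁ <;> rcases h₂.eq_or_real_univ_eq_one with e₂ | m₂
    · rw [le_antisymm (hS e₂) (hI e₁), zero_mul]
    · exact mul_nonpos_of_nonneg_of_nonpos (hI e₁) (by rw [m₂]; linarith [h₁.real_univ_le_one])
    · exact mul_nonpos_of_nonpos_of_nonneg (hS e₂) (by rw [m₁]; linarith [h₂.real_univ_le_one])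
    · rw [m₁, m₂, sub_self, mul_zero]
  linarith

end Monotonicity

/-- A weak-star measurable field of measures on `C_r` of mass at most one, defined `ν`-almost
everywhere. -/
structure IsSubprobabilityField (r : ℝ) (ν : Measure (Space N × ℝ))
    (z : Space N × ℝ → Measure (Space N × Space N)) : Prop where
  aemeasurable : ∀ f : Space N × Space N → ℝ, Continuous f →
    AEMeasurable (fun p => ∫ q, f q ∂(z p)) ν
  subprobability : ∀ᵐ p ∂ν, IsSubprobabilityOn r (z p)

namespace IsSubprobabilityField

variable {ν : Measure (Space N × ℝ)} {z : Space N × ℝ → Measure (Space N × Space N)} {B : ℝ}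

theorem aemeasurable_diffPairing (h : IsSubprobabilityField r ν z) {φ : Space N × ℝ → ℝ}
    (hφ : Continuous φ) (hB : ∀ p, |φ p| ≤ B) :
    AEMeasurable (fun p => diffPairing (fun x => φ (x, p.2)) p.1 (z p)) ν :=
  aemeasurable_integral_of_continuous (B := B + B)
    (f := fun p q => φ (p.1 + q.1, p.2) - φ (p.1 + q.2, p.2)) h.aemeasurable
    (h.subprobability.mono fun _ hp => hp.isFiniteMeasure)
    (fun _ _ => (abs_sub _ _).trans (add_le_add (hB _) (hB _))) (fun q => by fun_prop)
    (fun p => by fun_prop)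

theorem tendsto_integral_diffPairing (h : IsSubprobabilityField r ν z) {K : Set (Space N)}
    (hK : ν (Metric.cthickening r K ×ˢ univ) ≠ ⊤) {φ : ℕ → Space N × ℝ → ℝ}
    {f : Space N × ℝ → ℝ} (hc : ∀ n, Continuous (φ n)) (hB : ∀ n p, |φ n p| ≤ B)
    (hφ : ∀ n p, φ n p ≠ 0 → p.1 ∈ K)
    (hlim : ∀ᵐ p ∂ν, ∀ x, Tendsto (fun n => φ n (x, p.2)) atTop (𝓝 (f (x, p.2)))) :
    Integrable (fun p => diffPairing (fun x => f (x, p.2)) p.1 (z p)) ν ∧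
    Tendsto (fun n => ∫ p, diffPairing (fun x => φ n (x, p.2)) p.1 (z p) ∂ν) atTop
      (𝓝 (∫ p, diffPairing (fun x => f (x, p.2)) p.1 (z p) ∂ν)) := by
  have hmeas := fun n => (h.aemeasurable_diffPairing (hc n) (hB n)).aestronglyMeasurable
  have hgi : Integrable (fun p : Space N × ℝ =>
      (Metric.cthickening r K).indicator (fun _ => 2 * B) p.1) ν := by
    have := (integrable_indicator_iff (Metric.isClosed_cthickening.measurableSet.prod .univ)).2
      (integrableOn_const (C := 2 * B) hK)
    refine this.congr (Eventually.of_forall fun p => ?_)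
    by_cases hp : p.1 ∈ Metric.cthickening r K <;> simp [hp]
  have hbound : ∀ n, ∀ᵐ p ∂ν, ‖diffPairing (fun x => φ n (x, p.2)) p.1 (z p)‖ ≤
      (Metric.cthickening r K).indicator (fun _ => 2 * B) p.1 := fun n =>
    h.subprobability.mono fun p hp => hp.abs_diffPairing_le (fun _ => hB n _) fun _ => hφ n _
  have hconv : ∀ᵐ p ∂ν, Tendsto (fun n => diffPairing (fun x => φ n (x, p.2)) p.1 (z p)) atTop
      (𝓝 (diffPairing (fun x => f (x, p.2)) p.1 (z p))) := by
    filter_upwards [h.subprobability, hlim] with p hp hl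
    exact hp.tendsto_diffPairing (fun n => (hc n).comp (by fun_prop)) (fun n _ => hB n _) hl
  refine ⟨hgi.mono' (aestronglyMeasurable_of_tendsto_ae atTop hmeas hconv) ?_,
    tendsto_integral_of_dominated_convergence _ hmeas hgi hbound hconv⟩
  filter_upwards [ae_all_iff.2 hbound, hconv] with p hp hl
  exact le_of_tendsto hl.norm (Eventually.of_forall hp)

end IsSubprobabilityField

theorem tendsto_integral_div_of_continuousWithinAt {y : ℝ → ℝ} {t : ℝ} {ε : ℕ → ℝ}
    (hm : Measurable y) (hy : ContinuousWithinAt y (Iic t) t) (hε : ∀ n, 0 < ε n)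
    (hlim : Tendsto ε atTop (𝓝 0)) :
    Tendsto (fun n => (∫ s in (t - ε n)..t, y s) / ε n) atTop (𝓝 (y t)) := by
  have hder : HasDerivWithinAt (fun u => ∫ s in t..u, y s) (y t) (Iic t) t :=
    intervalIntegral.integral_hasDerivWithinAt_right IntervalIntegrable.refl
      hm.stronglyMeasurable.stronglyMeasurableAtFilter hy
  have hleft : Tendsto (fun n => t - ε n) atTop (𝓝[Iic t \ {t}] t) :=
    tendsto_nhdsWithin_iff.2 ⟨by simpa using tendsto_const_nhds (x := t).sub hlim,
      Eventually.of_forall fun n => ⟨by simpa using (hε n).le, by simpa using (hε n).ne'⟩⟩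
  refine ((hasDerivWithinAt_iff_tendsto_slope.1 hder).comp hleft).congr fun n => ?_
  rw [Function.comp_apply, slope_def_field, intervalIntegral.integral_same, sub_zero,
    intervalIntegral.integral_symm, sub_sub_cancel_left, neg_div_neg_eq]

section SliceIntegral

variable {V : Type*} [MeasureSpace V] {a b t₁ t₂ t ε B : ℝ} {K : Set V} {J : Set ℝ} {P : V × ℝ → ℝ}

/-- The integral of the time slice of `P` at time `t`. -/
noncomputable def sliceIntegral (P : V × ℝ → ℝ) (t : ℝ) : ℝ := ∫ x, P (x, t)

theorem measurable_sliceIntegral [SFinite (volume : Measure V)] (hP : Measurable P) :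
    Measurable (sliceIntegral P) :=
  hP.stronglyMeasurable.integral_prod_left'.measurable

/-- `P` is bounded by `B`, and its time slices between `a` and `b` vanish outside `K`. -/
structure IsConfined (a b B : ℝ) (K : Set V) (P : V × ℝ → ℝ) : Prop where
  measurable : Measurable P
  abs_le : ∀ p, |P p| ≤ B
  mem_of_ne_zero : ∀ x, ∀ t ∈ Ioo a b, P (x, t) ≠ 0 → x ∈ K

namespace IsConfined

theorem shift (h : IsConfined a b B K P) (ε : ℝ) :
    IsConfined (a + ε) (b + ε) B K fun p => P (p.1, p.2 - ε) where
  measurable := h.measurable.comp (by fun_prop)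
  abs_le _ := h.abs_le _
  mem_of_ne_zero x t ht :=
    h.mem_of_ne_zero x (t - ε) ⟨lt_sub_iff_add_lt.2 ht.1, sub_lt_iff_lt_add.2 ht.2⟩

theorem eq_zero_of_notMem (h : IsConfined a b B K P) (ht : t ∈ Ioo a b) {x : V} (hx : x ∉ K) :
    P (x, t) = 0 := by
  by_contra hne
  exact hx (h.mem_of_ne_zero x t ht hne)

theorem integrable_slice (h : IsConfined a b B K P) (hK : volume K ≠ ⊤) (ht : t ∈ Ioo a b) :
    Integrable fun x => P (x, t) := by
  simpa using integrable_mul_of_support_subset (integrableOn_const (C := (1 : ℝ)) hK)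
    (h.measurable.comp measurable_prodMk_right).aestronglyMeasurable (fun x => h.abs_le (x, t))
    fun x => h.mem_of_ne_zero x t ht

theorem abs_sliceIntegral_le (h : IsConfined a b B K P) (hK : volume K ≠ ⊤) (ht : t ∈ Ioo a b)
    {c : ℝ} (hc : ∀ x, |P (x, t)| ≤ c) : |sliceIntegral P t| ≤ c * volume.real K := by
  rw [sliceIntegral, ← setIntegral_eq_integral_of_forall_compl_eq_zero fun x hx =>
    h.eq_zero_of_notMem ht hx]
  exact norm_setIntegral_le_of_norm_le_const (f := fun x => P (x, t)) hK.lt_top fun x _ => hc x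

theorem continuousWithinAt_sliceIntegral (h : IsConfined a b B K P) (hKm : MeasurableSet K)
    (hK : volume K ≠ ⊤) (ht : t ∈ Ioo a b)
    (hleft : ∀ x, ContinuousWithinAt (fun s => P (x, s)) (Iic t) t) :
    ContinuousWithinAt (sliceIntegral P) (Iic t) t := by
  refine tendsto_integral_filter_of_dominated_convergence (K.indicator fun _ => B)
    (Eventually.of_forall fun s =>
      (h.measurable.comp measurable_prodMk_right).aestronglyMeasurable) ?_
    ((integrable_indicator_iff hKm).2 (integrableOn_const hK)) (Eventually.of_forall hleft)
  filter_upwards [Ioc_mem_nhdsLE ht.1] with s hs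
  refine Eventually.of_forall fun x => ?_
  by_cases hx : x ∈ K
  · rw [indicator_of_mem hx]
    exact h.abs_le _
  · rw [indicator_of_notMem hx, h.eq_zero_of_notMem ⟨hs.1, hs.2.trans_lt ht.2⟩ hx, norm_zero]

theorem integrableOn_univ_prod (h : IsConfined a b B K P) (hK : volume K ≠ ⊤)
    (hJ : J ⊆ Ioo a b) (hJm : MeasurableSet J) : IntegrableOn P (univ ×ˢ J) := by
  have hfin : volume (K ×ˢ J) ≠ ⊤ := by
    rw [Measure.volume_eq_prod, Measure.prod_prod]
    exact ENNReal.mul_ne_top hK ((measure_mono hJ).trans_lt measure_Ioo_lt_top).ne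
  refine IntegrableOn.of_forall_sdiff_eq_zero (s := K ×ˢ J)
    (IntegrableOn.of_bound hfin.lt_top h.measurable.aestronglyMeasurable B
      (Eventually.of_forall h.abs_le)) (MeasurableSet.univ.prod hJm) ?_
  rintro ⟨x, t⟩ ⟨⟨-, ht⟩, hx⟩
  exact h.eq_zero_of_notMem (hJ ht) fun hxK => hx ⟨hxK, ht⟩

variable [SFinite (volume : Measure V)]

theorem intervalIntegrable_sliceIntegral (h : IsConfined a b B K P) (hK : volume K ≠ ⊤)
    (ht₁ : t₁ ∈ Ioo a b) (ht₂ : t₂ ∈ Ioo a b) :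
    IntervalIntegrable (sliceIntegral P) volume t₁ t₂ := by
  refine intervalIntegrable_iff.2 (IntegrableOn.of_bound (by simp [uIoc])
    (measurable_sliceIntegral h.measurable).aestronglyMeasurable (B * volume.real K) ?_)
  filter_upwards [ae_restrict_mem measurableSet_uIoc] with t ht
  exact h.abs_sliceIntegral_le hK (ordConnected_Ioo.uIcc_subset ht₁ ht₂ (uIoc_subset_uIcc ht))
    fun x => h.abs_le _

theorem setIntegral_univ_prod (h : IsConfined a b B K P) (hK : volume K ≠ ⊤) (hJ : J ⊆ Ioo a b)
    (hJm : MeasurableSet J) : ∫ p in univ ×ˢ J, P p = ∫ t in J, sliceIntegral P t := by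
  have hi := h.integrableOn_univ_prod hK hJ hJm
  rw [IntegrableOn, Measure.volume_eq_prod, ← Measure.prod_restrict, Measure.restrict_univ] at hi
  rw [Measure.volume_eq_prod, ← Measure.prod_restrict, Measure.restrict_univ,
    integral_prod_symm _ hi]
  rfl

theorem setIntegral_shift_sub (h : IsConfined a b B K P) (hK : volume K ≠ ⊤) (hε : 0 ≤ ε)
    (ha : a < t₁ - ε) (h12 : t₁ ≤ t₂) (hb : t₂ < b) :
    IntegrableOn (fun p => P (p.1, p.2 - ε) - P p) (univ ×ˢ Ioc t₁ t₂) ∧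
    ∫ p in univ ×ˢ Ioc t₁ t₂, (P (p.1, p.2 - ε) - P p) =
      (∫ t in (t₁ - ε)..t₁, sliceIntegral P t) - ∫ t in (t₂ - ε)..t₂, sliceIntegral P t := by
  have hJ : Ioc t₁ t₂ ⊆ Ioo a b := fun t ht => ⟨by linarith [ht.1], ht.2.trans_lt hb⟩
  have hJε : Ioc t₁ t₂ ⊆ Ioo (a + ε) (b + ε) := fun t ht =>
    ⟨by linarith [ht.1], by linarith [ht.2]⟩
  have hint : ∀ {s t}, s ∈ Icc (t₁ - ε) t₂ → t ∈ Icc (t₁ - ε) t₂ →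
      IntervalIntegrable (sliceIntegral P) volume s t := fun hs ht =>
    h.intervalIntegrable_sliceIntegral hK ⟨ha.trans_le hs.1, hs.2.trans_lt hb⟩
      ⟨ha.trans_le ht.1, ht.2.trans_lt hb⟩
  have hi := h.integrableOn_univ_prod hK hJ measurableSet_Ioc
  have hiε := (h.shift ε).integrableOn_univ_prod hK hJε measurableSet_Ioc
  refine ⟨hiε.sub hi, ?_⟩
  have m₁ : t₁ ∈ Icc (t₁ - ε) t₂ := ⟨by linarith, h12⟩
  have m₂ : t₂ ∈ Icc (t₁ - ε) t₂ := ⟨by linarith, le_rfl⟩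
  have m₃ : t₁ - ε ∈ Icc (t₁ - ε) t₂ := ⟨le_rfl, by linarith⟩
  have m₄ : t₂ - ε ∈ Icc (t₁ - ε) t₂ := ⟨by linarith, by linarith⟩
  rw [integral_sub hiε hi, (h.shift ε).setIntegral_univ_prod hK hJε measurableSet_Ioc,
    h.setIntegral_univ_prod hK hJ measurableSet_Ioc, ← intervalIntegral.integral_of_le h12,
    ← intervalIntegral.integral_of_le h12,
    ← intervalIntegral.integral_interval_sub_interval_comm (hint m₃ m₄) (hint m₁ m₂) (hint m₃ m₁),
    ← intervalIntegral.integral_comp_sub_right]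
  rfl

end IsConfined

end SliceIntegral

section Truncation

/-- A smooth, jointly convex upper approximation of `max c v` with error at most `κ`. -/
noncomputable def softMax (κ c v : ℝ) : ℝ := (c + v + √((v - c) ^ 2 + κ ^ 2)) / 2

/-- The derivative of `softMax κ c v` with respect to `v`, as a function of `v - c`. -/
noncomputable def softStep (κ v : ℝ) : ℝ := (1 + v / √(v ^ 2 + κ ^ 2)) / 2

variable {κ : ℝ}

theorem sqrt_sq_add_sq_pos (hκ : 0 < κ) (v : ℝ) : 0 < √(v ^ 2 + κ ^ 2) :=
  Real.sqrt_pos.2 (by positivity)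

theorem abs_div_sqrt_le_one (κ v : ℝ) : |v / √(v ^ 2 + κ ^ 2)| ≤ 1 := by
  rw [abs_div, abs_of_nonneg (Real.sqrt_nonneg _)]
  exact div_le_one_of_le₀ (Real.abs_le_sqrt (by nlinarith [sq_nonneg κ])) (Real.sqrt_nonneg _)

theorem max_le_softMax (κ c v : ℝ) : max c v ≤ softMax κ c v := by
  have h : |v - c| ≤ √((v - c) ^ 2 + κ ^ 2) := Real.abs_le_sqrt (by nlinarith [sq_nonneg κ])
  unfold softMax
  rcases abs_le.1 h with ⟨h₁, h₂⟩
  exact max_le (by linarith) (by linarith)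

theorem softMax_le (hκ : 0 ≤ κ) (c v : ℝ) : softMax κ c v ≤ max c v + κ := by
  have h : √((v - c) ^ 2 + κ ^ 2) ≤ |v - c| + κ :=
    (Real.sqrt_le_left (by positivity)).2 (by nlinarith [abs_nonneg (v - c), sq_abs (v - c)])
  unfold softMax
  rcases le_total c v with hcv | hvc
  · rw [abs_of_nonneg (sub_nonneg.2 hcv)] at h
    rw [max_eq_right hcv]
    linarith
  · rw [abs_of_nonpos (sub_nonpos.2 hvc)] at h
    rw [max_eq_left hvc]
    linarith

theorem softStep_nonneg (κ v : ℝ) : 0 ≤ softStep κ v := by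
  have h := neg_le_of_abs_le (abs_div_sqrt_le_one κ v)
  unfold softStep
  linarith

theorem softStep_le_one (κ v : ℝ) : softStep κ v ≤ 1 := by
  have h := le_of_abs_le (abs_div_sqrt_le_one κ v)
  unfold softStep
  linarith

theorem continuous_softMax (κ : ℝ) : Continuous fun p : ℝ × ℝ => softMax κ p.1 p.2 := by
  unfold softMax
  fun_prop

theorem continuous_softStep (hκ : 0 < κ) : Continuous (softStep κ) :=
  (continuous_const.add (continuous_id.div (by fun_prop)
    fun v => (sqrt_sq_add_sq_pos hκ v).ne')).div_const 2

theorem div_sqrt_mul_le_sqrt_sub_sqrt (hκ : 0 < κ) (v w : ℝ) :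
    v / √(v ^ 2 + κ ^ 2) * (w - v) ≤ √(w ^ 2 + κ ^ 2) - √(v ^ 2 + κ ^ 2) := by
  have hsq : √(v ^ 2 + κ ^ 2) ^ 2 = v ^ 2 + κ ^ 2 := Real.sq_sqrt (by positivity)
  have cauchy_schwarz : v * w + κ ^ 2 ≤ √(v ^ 2 + κ ^ 2) * √(w ^ 2 + κ ^ 2) := by
    rw [← Real.sqrt_mul (by positivity)]
    exact Real.le_sqrt_of_sq_le (by nlinarith [mul_nonneg (sq_nonneg (v - w)) (sq_nonneg κ)])
  rw [div_mul_eq_mul_div, div_le_iff₀ (sqrt_sq_add_sq_pos hκ v)]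
  nlinarith

theorem gradient_le_softMax_sub (hκ : 0 < κ) (c c' v v' : ℝ) :
    (c' - c) * (1 - softStep κ (v - c)) + softStep κ (v - c) * (v' - v) ≤
      softMax κ c' v' - softMax κ c v := by
  have h := div_sqrt_mul_le_sqrt_sub_sqrt hκ (v - c) (v' - c')
  unfold softMax softStep
  linarith

theorem monotone_softMax (hκ : 0 < κ) (c : ℝ) : Monotone (softMax κ c) := fun v v' hv => by
  have h := gradient_le_softMax_sub hκ c c v v'
  linarith [mul_nonneg (softStep_nonneg κ (v - c)) (sub_nonneg.2 hv)]

theorem lipschitzWith_softMax (hκ : 0 < κ) (c : ℝ) : LipschitzWith 1 (softMax κ c) :=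
  LipschitzWith.of_le_add fun v w => by
    have h := gradient_le_softMax_sub hκ c c v w
    have hvw : softStep κ (v - c) * (v - w) ≤ dist v w :=
      (mul_le_mul_of_nonneg_left (le_abs_self _) (softStep_nonneg κ _)).trans
        (mul_le_of_le_one_left (abs_nonneg _) (softStep_le_one κ _))
    linarith

/-- The function `d` on space-time, smoothly truncated from below at the time-dependent level
`ℓ`. -/
noncomputable def truncated {V : Type*} (κ : ℝ) (ℓ : ℝ → ℝ) (d : V × ℝ → ℝ) (p : V × ℝ) : ℝ :=
  softMax κ (ℓ p.2) (d p)

variable {V : Type*} {ℓ : ℝ → ℝ} {d : V × ℝ → ℝ}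

theorem measurable_truncated [MeasurableSpace V] (hℓ : Measurable ℓ) (hd : Measurable d) :
    Measurable (truncated κ ℓ d) :=
  (continuous_softMax κ).measurable.comp ((hℓ.comp measurable_snd).prodMk hd)

theorem abs_truncated_le (hκ : 0 ≤ κ) (p : V × ℝ) : |truncated κ ℓ d p| ≤ |ℓ p.2| + |d p| + κ := by
  have hlower := (le_max_left _ _).trans (max_le_softMax κ (ℓ p.2) (d p))
  have hupper := (softMax_le hκ (ℓ p.2) (d p)).trans
    (add_le_add_left (max_le (le_abs_self _ |>.trans (le_add_of_nonneg_right (abs_nonneg _)))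
      (le_abs_self _ |>.trans (le_add_of_nonneg_left (abs_nonneg _)))) κ)
  refine abs_le.2 ⟨le_trans ?_ hlower, hupper⟩
  linarith [neg_abs_le (ℓ p.2), abs_nonneg (d p)]

theorem lipschitzWith_truncated [PseudoMetricSpace V] (hκ : 0 < κ) {t : ℝ}
    (hd : LipschitzWith 1 fun x => d (x, t)) : LipschitzWith 1 fun x => truncated κ ℓ d (x, t) := by
  simpa only [mul_one] using! (lipschitzWith_softMax hκ (ℓ t)).comp hd

theorem continuousWithinAt_truncated (hℓ : Continuous ℓ) {x : V} {s : Set ℝ} {t : ℝ}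
    (hd : ContinuousWithinAt (fun t => d (x, t)) s t) :
    ContinuousWithinAt (fun t => truncated κ ℓ d (x, t)) s t :=
  (continuous_softMax κ).continuousAt.comp_continuousWithinAt
    (hℓ.continuousWithinAt.prodMk hd)

end Truncation

section Penalty

variable {Δ : ℝ}

/-- The quadratic penalty of the values of `v` below `Δ`. -/
noncomputable def penalty (Δ v : ℝ) : ℝ := max (Δ - v) 0 ^ 2 / 2

theorem mul_sub_le_penalty_sub (Δ v w : ℝ) :
    max (Δ - v) 0 * (v - w) ≤ penalty Δ w - penalty Δ v := by
  have hv : max (Δ - v) 0 * (Δ - v) = max (Δ - v) 0 ^ 2 := by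
    rcases max_choice (Δ - v) 0 with h | h <;> rw [h] <;> ring
  have hw := mul_le_mul_of_nonneg_left (le_max_left (Δ - w) 0) (le_max_right (Δ - v) 0)
  unfold penalty
  nlinarith [sq_nonneg (max (Δ - v) 0 - max (Δ - w) 0)]

theorem penalty_nonneg (Δ v : ℝ) : 0 ≤ penalty Δ v := by
  unfold penalty
  positivity

theorem abs_penalty_le {v m : ℝ} (hm : 0 ≤ m) (h : Δ - v ≤ m) : |penalty Δ v| ≤ m ^ 2 / 2 := by
  rw [abs_of_nonneg (penalty_nonneg _ _), penalty]
  gcongr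
  exact max_le h hm

theorem continuous_penalty (Δ : ℝ) : Continuous (penalty Δ) := by
  unfold penalty
  fun_prop

theorem penalty_eq_zero_iff {v : ℝ} : penalty Δ v = 0 ↔ Δ ≤ v := by
  simp [penalty]

variable {V : Type*} {a b t₁ t₂ ε : ℝ} {K : Set V} {u : V × ℝ → ℝ}

theorem isConfined_penalty [MeasureSpace V] (hΔ : 0 ≤ Δ) (hu : Measurable u) (hu0 : ∀ p, 0 ≤ u p)
    (hK : ∀ x, ∀ t ∈ Ioo a b, u (x, t) < Δ → x ∈ K) :
    IsConfined a b (Δ ^ 2 / 2) K fun p => penalty Δ (u p) where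
  measurable := (continuous_penalty Δ).measurable.comp hu
  abs_le p := abs_penalty_le hΔ (sub_le_self Δ (hu0 p))
  mem_of_ne_zero x t ht hne := hK x t ht (not_le.1 (penalty_eq_zero_iff.not.1 hne))

/-- The amount by which `u` stays below `Δ` during the time interval `(t₁, t₂]`: minus the
derivative of the penalty. -/
noncomputable def deficit (Δ t₁ t₂ : ℝ) (u : V × ℝ → ℝ) (p : V × ℝ) : ℝ :=
  (Ioc t₁ t₂).indicator (fun _ => max (Δ - u p) 0) p.2

theorem deficit_of_mem {p : V × ℝ} (hp : p.2 ∈ Ioc t₁ t₂) :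
    deficit Δ t₁ t₂ u p = max (Δ - u p) 0 :=
  indicator_of_mem hp _

theorem deficit_of_notMem {p : V × ℝ} (hp : p.2 ∉ Ioc t₁ t₂) : deficit Δ t₁ t₂ u p = 0 :=
  indicator_of_notMem hp _

theorem measurable_deficit [MeasurableSpace V] (hu : Measurable u) :
    Measurable (deficit Δ t₁ t₂ u) :=
  ((measurable_const.sub hu).max measurable_const).indicator (measurable_snd measurableSet_Ioc)

theorem mem_of_deficit_ne_zero (ha : a ≤ t₁) (hb : t₂ < b)
    (hK : ∀ x, ∀ t ∈ Ioo a b, u (x, t) < Δ → x ∈ K) {p : V × ℝ} (hp : deficit Δ t₁ t₂ u p ≠ 0) :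
    p ∈ K ×ˢ Ioc t₁ t₂ := by
  have ht : p.2 ∈ Ioc t₁ t₂ := not_imp_comm.1 deficit_of_notMem hp
  rw [deficit_of_mem ht] at hp
  refine ⟨hK p.1 p.2 ⟨ha.trans_lt ht.1, ht.2.trans_lt hb⟩ ?_, ht⟩
  by_contra! hle
  exact hp (max_eq_right (sub_nonpos.2 hle))

theorem lipschitzWith_deficit [PseudoMetricSpace V] {L : ℝ≥0} {t : ℝ}
    (hu : LipschitzWith L fun x => u (x, t)) :
    LipschitzWith L fun x => deficit Δ t₁ t₂ u (x, t) := by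
  by_cases ht : t ∈ Ioc t₁ t₂
  · simp only [deficit, indicator_of_mem ht]
    simpa using! ((LipschitzWith.const Δ).sub hu).max_const 0
  · simp only [deficit, indicator_of_notMem ht]
    exact LipschitzWith.const' 0

theorem isForwardTest_deficit [NormedAddCommGroup V] [MeasureSpace V] (hΔ : 0 ≤ Δ)
    (hu : Measurable u) (hu0 : ∀ p, 0 ≤ u p) {L : ℝ≥0} (hL : ∀ t, LipschitzWith L fun x => u (x, t))
    (hK : ∀ x, ∀ t ∈ Ioo a b, u (x, t) < Δ → x ∈ K) (ha : a ≤ t₁) (hb : t₂ < b) :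
    IsForwardTest ε Δ (K ×ˢ Icc (t₁ - ε) t₂) (deficit Δ t₁ t₂ u) where
  measurable := measurable_deficit hu
  nonneg p := indicator_nonneg (fun _ _ => le_max_right _ _) _
  le_bound p := indicator_apply_le' (fun _ => max_le (sub_le_self Δ (hu0 p)) hΔ) fun _ => hΔ
  continuous_slice t := (lipschitzWith_deficit (hL t)).continuous
  mem_of_ne_zero p σ hσ hp := by
    obtain ⟨hx, ht⟩ := mem_of_deficit_ne_zero ha hb hK hp
    rw [Prod.fst_add, add_zero] at hx
    rw [Prod.snd_add] at ht
    exact ⟨hx, by linarith [ht.1, hσ.2], by linarith [ht.2, hσ.1]⟩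

end Penalty

section LocalSupersolution

variable {N : ℕ} {r a b t₁ t₂ ε κ Δ B : ℝ} {C : ℝ≥0} {U K : Set (Space N)} {ℓ : ℝ → ℝ}
  {d d₁ d₂ F : Space N × ℝ → ℝ} {z z₁ z₂ : Space N × ℝ → Measure (Space N × Space N)}

/-- `d` is a nonnegative supersolution, with field `z`, of the Minkowski flow between the times `a`
and `b`, for which `∂ₜ d ≥ Div^r z` and `(Div^r z)⁺ ≤ C` hold in `U`. -/
structure IsLocalSupersolution (r : ℝ) (C : ℝ≥0) (U : Set (Space N)) (a b : ℝ)
    (d : Space N × ℝ → ℝ) (z : Space N × ℝ → Measure (Space N × Space N)) : Prop where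
  isOpen : IsOpen U
  measurable : Measurable d
  nonneg : ∀ p, 0 ≤ d p
  lipschitz : ∀ t, LipschitzWith 1 fun x => d (x, t)
  left : ∀ t ∈ Ioo a b, ∀ x, ContinuousWithinAt (fun s => d (x, s)) (Iic t) t
  field : IsSubprobabilityField r (volume.restrict (univ ×ˢ Ioo a b)) z
  attains : ∀ᵐ p ∂volume.restrict (univ ×ˢ Ioo a b),
    diffPairing (fun x => d (x, p.2)) p.1 (z p) = essOsc (Metric.ball p.1 r) fun x => d (x, p.2)
  divergence : ∃ μpos μneg : Measure (Space N × ℝ),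
    IsTimeSupersolution (U ×ˢ Ioo a b) d μpos μneg ∧
    μpos.restrict (U ×ˢ Ioo a b) ≤ C • volume ∧
    ∀ φ : Space N × ℝ → ℝ, Continuous φ → HasCompactSupport φ → tsupport φ ⊆ U ×ˢ Ioo a b →
      (∫ p, φ p ∂μpos) - (∫ p, φ p ∂μneg) = -(1 / (2 * r)) *
        ∫ p in univ ×ˢ Ioo a b, diffPairing (fun x => φ (x, p.2)) p.1 (z p)

theorem integrableOn_truncated (hκ : 0 ≤ κ) (hℓ : Continuous ℓ) (hdm : Measurable d)
    {Q : Set (Space N × ℝ)} (hQ : IsCompact Q) (hd : IntegrableOn d Q) :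
    IntegrableOn (truncated κ ℓ d) Q := by
  have hbound : IntegrableOn (fun p : Space N × ℝ => |ℓ p.2| + |d p| + κ) Q :=
    (((by fun_prop : Continuous fun p : Space N × ℝ => |ℓ p.2|).continuousOn.integrableOn_compact
      hQ).add hd.abs).add (integrableOn_const hQ.measure_lt_top.ne)
  exact hbound.mono' (measurable_truncated hℓ.measurable hdm).aestronglyMeasurable
    (Eventually.of_forall (abs_truncated_le hκ))

theorem IsLocalSupersolution.integrable_mul_truncated_sub (h : IsLocalSupersolution r C U a b d z)
    (hκ : 0 ≤ κ) (hℓ : Continuous ℓ) (hε : 0 ≤ ε) {Q : Set (Space N × ℝ)} (hQ : IsCompact Q)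
    (hQU : Q ⊆ U ×ˢ Ioo a b) (hF : IsForwardTest ε B Q F) :
    Integrable fun p => F p * (truncated κ ℓ d p - truncated κ ℓ d (p - (0, ε))) := by
  obtain ⟨μpos, μneg, hd, -, -⟩ := h.divergence
  exact hF.integrable_mul_difference hε
    (integrableOn_truncated hκ hℓ h.measurable hQ (hd.integrableOn Q hQ hQU))

/-- Truncation at a level that grows with speed at least `C` preserves supersolutions: above the
level `∂ₜ d ≥ Div^r z`, and below it `C ≥ Div^r z`. -/
theorem IsLocalSupersolution.divergence_le_truncated_sub (h : IsLocalSupersolution r C U a b d z)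
    (hκ : 0 < κ) (hℓ : Continuous ℓ) (hℓC : ∀ s t, s ≤ t → C * (t - s) ≤ ℓ t - ℓ s)
    (hε : 0 ≤ ε) {Q : Set (Space N × ℝ)} (hQ : IsCompact Q) (hQU : Q ⊆ U ×ˢ Ioo a b)
    (hF : IsForwardTest ε B Q F) :
    -(1 / (2 * r)) * ∫ p in univ ×ˢ Ioo a b,
        diffPairing (fun x => forwardIntegral ε F (x, p.2)) p.1 (z p) ≤
      ∫ p, F p * (truncated κ ℓ d p - truncated κ ℓ d (p - (0, ε))) := by
  have hint := h.integrable_mul_truncated_sub hκ.le hℓ hε hQ hQU hF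
  obtain ⟨μpos, μneg, hd, hC, hpair⟩ := h.divergence
  let θ : Space N × ℝ → ℝ := fun p => softStep κ (d (p - (0, ε)) - ℓ (p.2 - ε))
  have hθm : Measurable θ := (continuous_softStep hκ).measurable.comp
    ((h.measurable.comp (by fun_prop)).sub (by fun_prop))
  have hθc : ∀ t, Continuous fun x => θ (x, t) := fun t =>
    have hshift : Continuous fun x => d (x - 0, t - ε) :=
      (h.lipschitz (t - ε)).continuous.comp (by fun_prop)
    (continuous_softStep hκ).comp (hshift.sub (continuous_const (y := ℓ (t - ε))))
  obtain ⟨hi, hle⟩ := hd.pairing_forwardIntegral_le_of_restrict_le hC (h.isOpen.prod isOpen_Ioo) hε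
    hQ hQU hF hθm (fun _ => softStep_nonneg κ _) (fun _ => softStep_le_one κ _) hθc
  rw [← hpair _ hF.continuous_forwardIntegral (hF.hasCompactSupport_forwardIntegral hε hQ)
    ((closure_minimal (hF.support_forwardIntegral_subset hε) hQ.isClosed).trans hQU)]
  refine hle.trans (integral_mono hi hint fun p => mul_le_mul_of_nonneg_left ?_ (hF.nonneg p))
  have hgrowth : C * ε * (1 - θ p) ≤ (ℓ p.2 - ℓ (p.2 - ε)) * (1 - θ p) :=
    mul_le_mul_of_nonneg_right (by simpa using hℓC (p.2 - ε) p.2 (sub_le_self _ hε))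
      (sub_nonneg.2 (softStep_le_one κ _))
  exact (add_le_add_left hgrowth _).trans (gradient_le_softMax_sub hκ _ _ _ _)

end LocalSupersolution

section EnergyDecay

/-- The sum of the truncations of `d₁` and `d₂` at the level `ℓ`. -/
noncomputable def truncatedSum {V : Type*} (κ : ℝ) (ℓ : ℝ → ℝ) (d₁ d₂ : V × ℝ → ℝ) (p : V × ℝ) :
    ℝ :=
  truncated κ ℓ d₁ p + truncated κ ℓ d₂ p

variable {N : ℕ} {r a b t₁ t₂ ε κ Δ : ℝ} {C : ℝ≥0} {U K : Set (Space N)} {ℓ : ℝ → ℝ}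
  {d₁ d₂ u : Space N × ℝ → ℝ} {z₁ z₂ : Space N × ℝ → Measure (Space N × Space N)}

theorem max_add_max_le_truncatedSum (κ : ℝ) (ℓ : ℝ → ℝ) (d₁ d₂ : Space N × ℝ → ℝ)
    (p : Space N × ℝ) : max (ℓ p.2) (d₁ p) + max (ℓ p.2) (d₂ p) ≤ truncatedSum κ ℓ d₁ d₂ p :=
  add_le_add (max_le_softMax _ _ _) (max_le_softMax _ _ _)

theorem truncatedSum_le (hκ : 0 ≤ κ) (p : Space N × ℝ) :
    truncatedSum κ ℓ d₁ d₂ p ≤ max (ℓ p.2) (d₁ p) + max (ℓ p.2) (d₂ p) + 2 * κ := by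
  have h₁ := softMax_le hκ (ℓ p.2) (d₁ p)
  have h₂ := softMax_le hκ (ℓ p.2) (d₂ p)
  unfold truncatedSum truncated
  linarith

theorem integral_deficit_mul_difference_le (hΔ : 0 ≤ Δ) (hu : Measurable u) (hu0 : ∀ p, 0 ≤ u p)
    (hK : volume K ≠ ⊤) (huK : ∀ x, ∀ t ∈ Ioo a b, u (x, t) < Δ → x ∈ K) (hε : 0 ≤ ε)
    (ha : a < t₁ - ε) (h12 : t₁ ≤ t₂) (hb : t₂ < b)
    (hi : Integrable fun p => deficit Δ t₁ t₂ u p * (u p - u (p - (0, ε)))) :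
    ∫ p, deficit Δ t₁ t₂ u p * (u p - u (p - (0, ε))) ≤
      (∫ t in (t₁ - ε)..t₁, sliceIntegral (fun p => penalty Δ (u p)) t) -
        ∫ t in (t₂ - ε)..t₂, sliceIntegral (fun p => penalty Δ (u p)) t := by
  obtain ⟨hiP, hP⟩ := (isConfined_penalty hΔ hu hu0 huK).setIntegral_shift_sub hK hε ha h12 hb
  rw [← hP, ← setIntegral_eq_integral_of_forall_compl_eq_zero (s := univ ×ˢ Ioc t₁ t₂)
    fun p hp => by rw [deficit_of_notMem fun ht => hp ⟨mem_univ _, ht⟩, zero_mul]]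
  refine setIntegral_mono_on hi.integrableOn hiP (MeasurableSet.univ.prod measurableSet_Ioc)
    fun p hp => ?_
  rw [deficit_of_mem hp.2]
  have hshift : p - (0, ε) = (p.1, p.2 - ε) := Prod.ext (sub_zero p.1) rfl
  rw [hshift]
  exact mul_sub_le_penalty_sub Δ (u p) (u (p.1, p.2 - ε))

theorem diffPairing_deficit_add_nonpos (hκ : 0 < κ) {p : Space N × ℝ}
    {ζ₁ ζ₂ : Measure (Space N × Space N)} {S₁ I₁ S₂ I₂ : ℝ}
    (h₁ : IsExtremal r (fun x => d₁ (x, p.2)) p.1 ζ₁ S₁ I₁)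
    (h₂ : IsExtremal r (fun x => d₂ (x, p.2)) p.1 ζ₂ S₂ I₂)
    (hc : Continuous fun x => truncatedSum κ ℓ d₁ d₂ (x, p.2)) :
    diffPairing (fun x => deficit Δ t₁ t₂ (truncatedSum κ ℓ d₁ d₂) (x, p.2)) p.1 ζ₁ +
      diffPairing (fun x => deficit Δ t₁ t₂ (truncatedSum κ ℓ d₁ d₂) (x, p.2)) p.1 ζ₂ ≤ 0 := by
  by_cases ht : p.2 ∈ Ioc t₁ t₂
  · have hmono := monotone_softMax hκ (ℓ p.2)
    simp only [deficit, indicator_of_mem ht]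
    exact h₁.diffPairing_add_nonpos h₂
      (γ := fun v w => max (Δ - (softMax κ (ℓ p.2) v + softMax κ (ℓ p.2) w)) 0)
      (fun w v v' hv => max_le_max_right 0 (sub_le_sub_left (add_le_add_left (hmono hv) _) Δ))
      (fun v w w' hw => max_le_max_right 0 (sub_le_sub_left (add_le_add_right (hmono hw) _) Δ))
      ((continuous_const.sub hc).max continuous_const)
  · simp [deficit, indicator_of_notMem ht, diffPairing]

/-- Two supersolutions whose truncations at the level `ℓ` sum to less than `Δ` only in a compact
subset `K` of the region `U` where the differential inequalities hold. -/
structure IsComparisonPair (r Δ : ℝ) (C : ℝ≥0) (ℓ : ℝ → ℝ) (K U : Set (Space N)) (a b : ℝ)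
    (d₁ d₂ : Space N × ℝ → ℝ) (z₁ z₂ : Space N × ℝ → Measure (Space N × Space N)) : Prop where
  nonneg : 0 ≤ Δ
  continuous_level : Continuous ℓ
  level_growth : ∀ s t, s ≤ t → C * (t - s) ≤ ℓ t - ℓ s
  isCompact : IsCompact K
  subset : K ⊆ U
  fst : IsLocalSupersolution r C U a b d₁ z₁
  snd : IsLocalSupersolution r C U a b d₂ z₂
  mem_of_lt : ∀ x, ∀ t ∈ Ioo a b, max (ℓ t) (d₁ (x, t)) + max (ℓ t) (d₂ (x, t)) < Δ → x ∈ K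

namespace IsComparisonPair

theorem measurable (h : IsComparisonPair r Δ C ℓ K U a b d₁ d₂ z₁ z₂) :
    Measurable (truncatedSum κ ℓ d₁ d₂) :=
  (measurable_truncated h.continuous_level.measurable h.fst.measurable).add
    (measurable_truncated h.continuous_level.measurable h.snd.measurable)

theorem truncatedSum_nonneg (h : IsComparisonPair r Δ C ℓ K U a b d₁ d₂ z₁ z₂)
    (p : Space N × ℝ) : 0 ≤ truncatedSum κ ℓ d₁ d₂ p :=
  (add_nonneg (le_max_of_le_right (h.fst.nonneg p)) (le_max_of_le_right (h.snd.nonneg p))).trans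
    (max_add_max_le_truncatedSum κ ℓ d₁ d₂ p)

theorem lipschitzWith (h : IsComparisonPair r Δ C ℓ K U a b d₁ d₂ z₁ z₂) (hκ : 0 < κ) (t : ℝ) :
    LipschitzWith (1 + 1) fun x => truncatedSum κ ℓ d₁ d₂ (x, t) :=
  (lipschitzWith_truncated hκ (h.fst.lipschitz t)).add
    (lipschitzWith_truncated hκ (h.snd.lipschitz t))

theorem mem_of_truncatedSum_lt (h : IsComparisonPair r Δ C ℓ K U a b d₁ d₂ z₁ z₂)
    (x : Space N) {t : ℝ} (ht : t ∈ Ioo a b)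
    (hlt : truncatedSum κ ℓ d₁ d₂ (x, t) < Δ) : x ∈ K :=
  h.mem_of_lt x t ht ((max_add_max_le_truncatedSum κ ℓ d₁ d₂ (x, t)).trans_lt hlt)

theorem isConfined (h : IsComparisonPair r Δ C ℓ K U a b d₁ d₂ z₁ z₂) :
    IsConfined a b (Δ ^ 2 / 2) K fun p => penalty Δ (truncatedSum κ ℓ d₁ d₂ p) :=
  isConfined_penalty h.nonneg h.measurable h.truncatedSum_nonneg
    fun x _ => h.mem_of_truncatedSum_lt x

theorem isForwardTest (h : IsComparisonPair r Δ C ℓ K U a b d₁ d₂ z₁ z₂)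
    (hκ : 0 < κ) (ha : a ≤ t₁) (hb : t₂ < b) :
    IsForwardTest ε Δ (K ×ˢ Icc (t₁ - ε) t₂) (deficit Δ t₁ t₂ (truncatedSum κ ℓ d₁ d₂)) :=
  isForwardTest_deficit h.nonneg h.measurable h.truncatedSum_nonneg (h.lipschitzWith hκ)
    (fun x _ => h.mem_of_truncatedSum_lt x) ha hb

theorem divergence_le_energy_sub (h : IsComparisonPair r Δ C ℓ K U a b d₁ d₂ z₁ z₂)
    (hκ : 0 < κ) (hε : 0 ≤ ε) (ha : a < t₁ - ε) (h12 : t₁ ≤ t₂)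
    (hb : t₂ < b) : -(1 / (2 * r)) * ((∫ p in univ ×ˢ Ioo a b, diffPairing (fun x =>
        forwardIntegral ε (deficit Δ t₁ t₂ (truncatedSum κ ℓ d₁ d₂)) (x, p.2)) p.1 (z₁ p)) +
      ∫ p in univ ×ˢ Ioo a b, diffPairing (fun x =>
        forwardIntegral ε (deficit Δ t₁ t₂ (truncatedSum κ ℓ d₁ d₂)) (x, p.2)) p.1 (z₂ p)) ≤
      (∫ t in (t₁ - ε)..t₁, sliceIntegral (fun p => penalty Δ (truncatedSum κ ℓ d₁ d₂ p)) t) -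
        ∫ t in (t₂ - ε)..t₂, sliceIntegral (fun p => penalty Δ (truncatedSum κ ℓ d₁ d₂ p)) t := by
  have hF := h.isForwardTest hκ (ε := ε) (ha.le.trans (sub_le_self t₁ hε)) hb
  have hQ : IsCompact (K ×ˢ Icc (t₁ - ε) t₂) := h.isCompact.prod isCompact_Icc
  have hQU : K ×ˢ Icc (t₁ - ε) t₂ ⊆ U ×ˢ Ioo a b := prod_mono h.subset (Icc_subset_Ioo ha hb)
  have hi₁ := h.fst.integrable_mul_truncated_sub hκ.le h.continuous_level hε hQ hQU hF
  have hi₂ := h.snd.integrable_mul_truncated_sub hκ.le h.continuous_level hε hQ hQU hF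
  have hsum : (fun p => deficit Δ t₁ t₂ (truncatedSum κ ℓ d₁ d₂) p *
      (truncatedSum κ ℓ d₁ d₂ p - truncatedSum κ ℓ d₁ d₂ (p - (0, ε)))) = _ :=
    funext fun p => (congrArg _ (add_sub_add_comm _ _ _ _)).trans (mul_add _ _ _)
  rw [mul_add]
  refine (add_le_add
    (h.fst.divergence_le_truncated_sub hκ h.continuous_level h.level_growth hε hQ hQU hF)
    (h.snd.divergence_le_truncated_sub hκ h.continuous_level h.level_growth hε hQ hQU
      hF)).trans ?_
  rw [← integral_add hi₁ hi₂, ← hsum]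
  exact integral_deficit_mul_difference_le h.nonneg h.measurable h.truncatedSum_nonneg
    h.isCompact.measure_lt_top.ne (fun x _ => h.mem_of_truncatedSum_lt x) hε ha h12 hb
    (hsum ▸ hi₁.add hi₂)

theorem integral_diffPairing_deficit_add_nonpos (h : IsComparisonPair r Δ C ℓ K U a b d₁ d₂ z₁ z₂)
    (hκ : 0 < κ) (hr : 0 < r)
    (hi₁ : IntegrableOn (fun p => diffPairing (fun x =>
      deficit Δ t₁ t₂ (truncatedSum κ ℓ d₁ d₂) (x, p.2)) p.1 (z₁ p)) (univ ×ˢ Ioo a b))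
    (hi₂ : IntegrableOn (fun p => diffPairing (fun x =>
      deficit Δ t₁ t₂ (truncatedSum κ ℓ d₁ d₂) (x, p.2)) p.1 (z₂ p)) (univ ×ˢ Ioo a b)) :
    (∫ p in univ ×ˢ Ioo a b, diffPairing (fun x =>
        deficit Δ t₁ t₂ (truncatedSum κ ℓ d₁ d₂) (x, p.2)) p.1 (z₁ p)) +
      (∫ p in univ ×ˢ Ioo a b, diffPairing (fun x =>
        deficit Δ t₁ t₂ (truncatedSum κ ℓ d₁ d₂) (x, p.2)) p.1 (z₂ p)) ≤ 0 := by
  rw [← integral_add hi₁ hi₂]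
  refine integral_nonpos_of_ae ?_
  filter_upwards [h.fst.field.subprobability, h.fst.attains, h.snd.field.subprobability,
    h.snd.attains] with p hz₁ hosc₁ hz₂ hosc₂
  exact diffPairing_deficit_add_nonpos hκ
    (hz₁.isExtremal hr (h.fst.lipschitz p.2).continuous hosc₁)
    (hz₂.isExtremal hr (h.snd.lipschitz p.2).continuous hosc₂) (h.lipschitzWith hκ p.2).continuous

theorem tendsto_energy_mean (h : IsComparisonPair r Δ C ℓ K U a b d₁ d₂ z₁ z₂)
    {ε : ℕ → ℝ} {t : ℝ} (ht : t ∈ Ioo a b) (hε : ∀ n, 0 < ε n)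
    (hlim : Tendsto ε atTop (𝓝 0)) :
    Tendsto (fun n => (∫ s in (t - ε n)..t,
        sliceIntegral (fun p => penalty Δ (truncatedSum κ ℓ d₁ d₂ p)) s) / ε n) atTop
      (𝓝 (sliceIntegral (fun p => penalty Δ (truncatedSum κ ℓ d₁ d₂ p)) t)) := by
  refine tendsto_integral_div_of_continuousWithinAt
    (measurable_sliceIntegral h.isConfined.measurable)
    (h.isConfined.continuousWithinAt_sliceIntegral h.isCompact.measurableSet
      h.isCompact.measure_lt_top.ne ht fun x => ?_) hε hlim
  exact (continuous_penalty Δ).continuousAt.comp_continuousWithinAt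
    ((continuousWithinAt_truncated h.continuous_level (h.fst.left t ht x)).add
      (continuousWithinAt_truncated h.continuous_level (h.snd.left t ht x)))

theorem tendsto_integral_diffPairing_mean (h : IsComparisonPair r Δ C ℓ K U a b d₁ d₂ z₁ z₂)
    (hκ : 0 < κ)
    {z : Space N × ℝ → Measure (Space N × Space N)}
    (hz : IsSubprobabilityField r (volume.restrict (univ ×ˢ Ioo a b)) z) {ε : ℕ → ℝ}
    (hε : ∀ n, 0 < ε n) (hlim : Tendsto ε atTop (𝓝 0)) (ha : a ≤ t₁) (hb : t₂ < b) :
    IntegrableOn (fun p => diffPairing (fun x =>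
      deficit Δ t₁ t₂ (truncatedSum κ ℓ d₁ d₂) (x, p.2)) p.1 (z p)) (univ ×ˢ Ioo a b) ∧
    Tendsto (fun n => (∫ p in univ ×ˢ Ioo a b, diffPairing (fun x =>
      forwardIntegral (ε n) (deficit Δ t₁ t₂ (truncatedSum κ ℓ d₁ d₂)) (x, p.2)) p.1 (z p)) / ε n)
      atTop (𝓝 (∫ p in univ ×ˢ Ioo a b, diffPairing (fun x =>
        deficit Δ t₁ t₂ (truncatedSum κ ℓ d₁ d₂) (x, p.2)) p.1 (z p))) := by
  have hF := fun n => h.isForwardTest hκ (ε := ε n) ha hb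
  have hfin : volume.restrict (univ ×ˢ Ioo a b) (Metric.cthickening r K ×ˢ univ) ≠ ⊤ := by
    rw [Measure.restrict_apply (Metric.isClosed_cthickening.measurableSet.prod .univ),
      prod_inter_prod, inter_univ, univ_inter, Measure.volume_eq_prod, Measure.prod_prod]
    exact ENNReal.mul_ne_top h.isCompact.cthickening.measure_lt_top.ne measure_Ioo_lt_top.ne
  simp only [← integral_div, ← diffPairing_div]
  refine hz.tendsto_integral_diffPairing (B := Δ) hfin
    (fun n => (hF n).continuous_forwardIntegral.div_const _) (fun n p => ?_) (fun n p hp => ?_)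
    (ae_restrict_of_ae (Measure.quasiMeasurePreserving_snd.ae
      (ae_tendsto_forwardIntegral_div (hF 0).measurable (hF 0).abs_le
        (fun t => lipschitzWith_deficit (h.lipschitzWith hκ t)) hε hlim)))
  · rw [abs_div, abs_of_pos (hε n), div_le_iff₀ (hε n)]
    exact abs_forwardIntegral_le (hε n).le (hF n).abs_le p
  · exact ((hF n).support_forwardIntegral_subset (hε n).le
      fun h0 => hp (by rw [h0, zero_div])).1

theorem antitoneOn_energy (h : IsComparisonPair r Δ C ℓ K U a b d₁ d₂ z₁ z₂)
    (hκ : 0 < κ) (hr : 0 < r) :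
    AntitoneOn (sliceIntegral fun p => penalty Δ (truncatedSum κ ℓ d₁ d₂ p)) (Ioo a b) := by
  intro t₁ ht₁ t₂ ht₂ h12
  let ε : ℕ → ℝ := fun n => (t₁ - a) / 2 / (n + 1)
  have hta : 0 < (t₁ - a) / 2 := half_pos (sub_pos.2 ht₁.1)
  have hε : ∀ n, 0 < ε n := fun n => by positivity
  have hlim : Tendsto ε atTop (𝓝 0) := tendsto_const_nhds.div_atTop
    (tendsto_atTop_add_const_right _ _ tendsto_natCast_atTop_atTop)
  have hεa : ∀ n, a < t₁ - ε n := fun n => by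
    have : ε n ≤ (t₁ - a) / 2 := div_le_self hta.le (by linarith [Nat.cast_nonneg (α := ℝ) n])
    linarith
  obtain ⟨hi₁, hlim₁⟩ :=
    h.tendsto_integral_diffPairing_mean hκ h.fst.field hε hlim ht₁.1.le ht₂.2
  obtain ⟨hi₂, hlim₂⟩ :=
    h.tendsto_integral_diffPairing_mean hκ h.snd.field hε hlim ht₁.1.le ht₂.2
  have hnonneg := mul_nonneg_of_nonpos_of_nonpos
    (neg_nonpos.2 (by positivity : 0 ≤ 1 / (2 * r)))
    (h.integral_diffPairing_deficit_add_nonpos hκ hr hi₁ hi₂)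
  refine sub_nonneg.1 (hnonneg.trans (le_of_tendsto_of_tendsto'
    ((hlim₁.add hlim₂).const_mul (-(1 / (2 * r))))
    ((h.tendsto_energy_mean ht₁ hε hlim).sub (h.tendsto_energy_mean ht₂ hε hlim)) fun n => ?_))
  rw [← add_div, ← mul_div_assoc, ← sub_div]
  exact div_le_div_of_nonneg_right (h.divergence_le_energy_sub hκ (hε n).le (hεa n) h12 ht₂.2)
    (hε n).le

theorem energy_eq_zero (h : IsComparisonPair r Δ C ℓ K U a b d₁ d₂ z₁ z₂) (hκ : 0 < κ) (hr : 0 < r)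
    (hinit : ∀ m > 0, ∀ᶠ s in 𝓝[>] a, ∀ x, Δ - m ≤ d₁ (x, s) + d₂ (x, s)) {t : ℝ}
    (ht : t ∈ Ioo a b) :
    sliceIntegral (fun p => penalty Δ (truncatedSum κ ℓ d₁ d₂ p)) t = 0 := by
  have hsmall : ∀ m ∈ Ioi (0 : ℝ), sliceIntegral (fun p => penalty Δ (truncatedSum κ ℓ d₁ d₂ p)) t ≤
      m ^ 2 / 2 * volume.real K := fun m hm => by
    obtain ⟨s, hs, has, hst⟩ := ((hinit m hm).and (Ioo_mem_nhdsGT ht.1)).exists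
    have hsb : s ∈ Ioo a b := ⟨has, hst.trans ht.2⟩
    refine (h.antitoneOn_energy hκ hr hsb ht hst.le).trans ((le_abs_self _).trans
      (h.isConfined.abs_sliceIntegral_le h.isCompact.measure_lt_top.ne hsb fun x =>
        abs_penalty_le (le_of_lt hm) (sub_le_comm.1 ((hs x).trans ?_))))
    exact (add_le_add (le_max_right _ _) (le_max_right _ _)).trans
      (max_add_max_le_truncatedSum κ ℓ d₁ d₂ (x, s))
  refine le_antisymm ?_ (integral_nonneg fun x => penalty_nonneg _ _)
  have hlim : Tendsto (fun m : ℝ => m ^ 2 / 2 * volume.real K) (𝓝[>] 0) (𝓝 0) :=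
    (Continuous.tendsto' (by fun_prop) 0 0 (by simp)).mono_left nhdsWithin_le_nhds
  exact ge_of_tendsto hlim (eventually_mem_nhdsWithin.mono hsmall)

theorem le_truncatedSum (h : IsComparisonPair r Δ C ℓ K U a b d₁ d₂ z₁ z₂) (hκ : 0 < κ) (hr : 0 < r)
    (hinit : ∀ m > 0, ∀ᶠ s in 𝓝[>] a, ∀ x, Δ - m ≤ d₁ (x, s) + d₂ (x, s)) {t : ℝ}
    (ht : t ∈ Ioo a b) (x : Space N) : Δ ≤ truncatedSum κ ℓ d₁ d₂ (x, t) := by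
  have hcont : Continuous fun x => penalty Δ (truncatedSum κ ℓ d₁ d₂ (x, t)) :=
    (continuous_penalty Δ).comp (h.lipschitzWith hκ t).continuous
  have hae := (integral_eq_zero_iff_of_nonneg (fun x => penalty_nonneg _ _)
    (h.isConfined.integrable_slice h.isCompact.measure_lt_top.ne ht)).1
    (h.energy_eq_zero hκ hr hinit ht)
  exact penalty_eq_zero_iff.1
    (congrFun ((hcont.ae_eq_iff_eq volume continuous_const).1 hae) x)

theorem le_max_add_max (h : IsComparisonPair r Δ C ℓ K U a b d₁ d₂ z₁ z₂) (hr : 0 < r)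
    (hinit : ∀ m > 0, ∀ᶠ s in 𝓝[>] a, ∀ x, Δ - m ≤ d₁ (x, s) + d₂ (x, s)) {t : ℝ}
    (ht : t ∈ Ioo a b) (x : Space N) : Δ ≤ max (ℓ t) (d₁ (x, t)) + max (ℓ t) (d₂ (x, t)) := by
  refine le_of_forall_pos_le_add fun ε hε => ?_
  refine (h.le_truncatedSum (half_pos hε) hr hinit ht x).trans
    ((truncatedSum_le (half_pos hε).le (x, t)).trans_eq ?_)
  rw [mul_div_cancel₀ ε two_ne_zero]

end IsComparisonPair

end EnergyDecay

section SeparatedSets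

/-- Two sets of points at mutual distance at least `Δ`. -/
def Separated {X : Type*} [PseudoMetricSpace X] (Δ : ℝ) (A B : Set X) : Prop :=
  ∀ x ∈ A, ∀ y ∈ B, Δ ≤ dist x y

section MetricSpace

variable {X : Type*} [PseudoMetricSpace X] {Δ δ : ℝ} {A B : Set X}

theorem Separated.symm (h : Separated Δ A B) : Separated Δ B A := fun x hx y hy =>
  (h y hy x hx).trans_eq (dist_comm y x)

theorem Separated.mono {A' B' : Set X} (h : Separated Δ A B) (hA : A' ⊆ A) (hB : B' ⊆ B) :
    Separated Δ A' B' :=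
  fun x hx y hy => h x (hA hx) y (hB hy)

theorem Separated.closure_right (h : Separated Δ A B) : Separated Δ A (closure B) := fun x hx =>
  closure_minimal (h x hx) (isClosed_le continuous_const (continuous_const.dist continuous_id))

theorem Separated.disjoint (h : Separated Δ A B) (hΔ : 0 < Δ) : Disjoint A B :=
  disjoint_left.2 fun x hA hB => hΔ.not_ge ((h x hA x hB).trans_eq (dist_self x))

theorem Separated.le_infDist_add (h : Separated Δ A B) (hA : A.Nonempty) (hB : B.Nonempty)
    (x : X) : Δ ≤ Metric.infDist x A + Metric.infDist x B := by
  rw [← sub_le_iff_le_add, Metric.le_infDist hA]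
  intro y hy
  rw [sub_le_comm, Metric.le_infDist hB]
  intro w hw
  linarith [h y hy w hw, dist_triangle_left y w x]

/-- The points at distance at least `c` from both `A` and `B` and at most `R` from `A`; outside it
the distances to two separated sets already have a large sum. -/
def strip {X : Type*} [PseudoMetricSpace X] (c R : ℝ) (A B : Set X) : Set X :=
  {x | c ≤ Metric.infDist x A ∧ c ≤ Metric.infDist x B ∧ Metric.infDist x A ≤ R}

theorem isCompact_strip [ProperSpace X] {c R : ℝ} (hne : A.Nonempty)
    (hA : Bornology.IsBounded A) : IsCompact (strip c R A B) := by
  refine Metric.isCompact_of_isClosed_isBounded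
    ((isClosed_le continuous_const (Metric.continuous_infDist_pt A)).inter
      ((isClosed_le continuous_const (Metric.continuous_infDist_pt B)).inter
        (isClosed_le (Metric.continuous_infDist_pt A) continuous_const)))
    ((hA.thickening (δ := R + 1)).subset fun x hx => ?_)
  obtain ⟨y, hy, hxy⟩ := (Metric.infDist_lt_iff hne).1 (hx.2.2.trans_lt (lt_add_one R))
  exact Metric.mem_thickening_iff.2 ⟨y, hy, hxy⟩

theorem mem_strip {c l α β : ℝ} {x : X} (hc : 0 ≤ c) (hl : c + δ ≤ l)
    (hΔ : Δ ≤ Metric.infDist x A + Metric.infDist x B) (hα : Metric.infDist x A - δ ≤ α)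
    (hβ : Metric.infDist x B - δ ≤ β) (hlt : max l α + max l β < Δ) : x ∈ strip c Δ A B := by
  have hlα := add_le_add (le_max_right l α) (le_max_left l β)
  have hlβ := add_le_add (le_max_left l α) (le_max_right l β)
  exact ⟨by linarith, by linarith, by linarith⟩

theorem infDist_sub_le_of_subset_thickening (hA : A.Nonempty) (h : A ⊆ Metric.thickening δ B)
    (x : X) : Metric.infDist x B - δ ≤ Metric.infDist x A := by
  refine (Metric.le_infDist hA).2 fun y hy => ?_
  obtain ⟨w, hw, hyw⟩ := Metric.mem_thickening_iff.1 (h hy)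
  linarith [Metric.infDist_le_dist_of_mem (x := x) hw, dist_triangle x y w]

end MetricSpace

theorem separated_of_le_max_add_max {V : Type*} [SeminormedAddCommGroup V] [NormedSpace ℝ V]
    {A B : Set V} {Δ l : ℝ} (hl : 2 * l < Δ)
    (h : ∀ x, Δ ≤ max l (Metric.infDist x A) + max l (Metric.infDist x B)) :
    Separated Δ A B := by
  intro x hx y hy
  by_contra! hlt
  have hA : Metric.infDist (midpoint ℝ x y) A ≤ dist x y / 2 :=
    (Metric.infDist_le_dist_of_mem hx).trans_eq (by simp [dist_midpoint_left]; ring)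
  have hB : Metric.infDist (midpoint ℝ x y) B ≤ dist x y / 2 :=
    (Metric.infDist_le_dist_of_mem hy).trans_eq (by simp [dist_midpoint_right]; ring)
  have hmax : max l (dist x y / 2) < Δ / 2 := max_lt (by linarith) (by linarith)
  linarith [h (midpoint ℝ x y), max_le_max_left l hA, max_le_max_left l hB]

theorem le_setDist_iff {N : ℕ} {c : ℝ≥0} {A B : Set (Space N)} :
    (c : ENNReal) ≤ setDist A B ↔ Separated c A B := by
  simp only [setDist, le_iInf_iff, Separated, edist_nndist, ENNReal.coe_le_coe, ← NNReal.coe_le_coe,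
    coe_nndist]

theorem KuratowskiTendsto.tendsto_infDist {N : ℕ} {D : ℕ → Set (Space N)} {D' : Set (Space N)}
    (h : KuratowskiTendsto D D') (hD : ∀ n, (D n).Nonempty) (hD' : D'.Nonempty) (x : Space N) :
    Tendsto (fun n => Metric.infDist x (D n)) atTop (𝓝 (Metric.infDist x D')) := by
  refine tendsto_order.2 ⟨fun c hc => ?_, fun c hc => ?_⟩
  · obtain ⟨c', hcc', hc'⟩ := exists_between hc
    choose u hu hxu using fun n => (Metric.infDist_lt_iff (x := x) (hD n)).1
      (lt_add_of_pos_right _ (sub_pos.2 hcc'))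
    by_contra hcon
    have hfreq : ∃ᶠ n in atTop, u n ∈ Metric.closedBall x c' :=
      (not_eventually.1 hcon).mono fun n hn =>
        Metric.mem_closedBall'.2 (by linarith [hxu n, not_lt.1 hn])
    obtain ⟨y, hy, hcluster⟩ := (isCompact_closedBall x c').exists_mapClusterPt_of_frequently hfreq
    exact hc'.not_ge ((Metric.infDist_le_dist_of_mem (h.1 u hu y hcluster)).trans
      (Metric.mem_closedBall'.1 hy))
  · obtain ⟨y, hy, hyc⟩ := (Metric.infDist_lt_iff hD').1 hc
    obtain ⟨v, hv, hvlim⟩ := h.2 y hy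
    filter_upwards [(tendsto_const_nhds.dist hvlim).eventually_lt_const hyc] with n hn
    exact (Metric.infDist_le_dist_of_mem (hv n)).trans_lt hn

end SeparatedSets

section TimeInduction

variable {α : Type*} [TopologicalSpace α] {P : α → Prop} {t₀ : α}

theorem eventually_nhdsGT_forall_Ioo [LinearOrder α] [OrderTopology α] [NoMaxOrder α]
    (h : ∀ᶠ s in 𝓝[>] t₀, P s) : ∀ᶠ t in 𝓝[>] t₀, ∀ s ∈ Ioo t₀ t, P s := by
  obtain ⟨u, hu, hP⟩ := mem_nhdsGT_iff_exists_Ioo_subset.1 h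
  filter_upwards [Ioo_mem_nhdsGT hu] with t ht s hs
  exact hP ⟨hs.1, hs.2.trans ht.2⟩

theorem forall_ge_of_propagation [ConditionallyCompleteLinearOrder α] [OrderTopology α]
    (h₀ : P t₀) (hleft : ∀ t, t₀ < t → (∀ s ∈ Ico t₀ t, P s) → P t)
    (hright : ∀ t, t₀ ≤ t → P t → ∀ᶠ s in 𝓝[>] t, P s) : ∀ t, t₀ ≤ t → P t := by
  by_contra! hcon
  let S := {t | t₀ ≤ t ∧ ¬P t}
  have hne : S.Nonempty := hcon
  have hbd : BddBelow S := ⟨t₀, fun _ hs => hs.1⟩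
  have hm : t₀ ≤ sInf S := le_csInf hne fun _ hs => hs.1
  have hlt : ∀ s ∈ Ico t₀ (sInf S), P s := fun s hs =>
    by_contra fun hPs => hs.2.not_ge (csInf_le hbd ⟨hs.1, hPs⟩)
  have hPm : P (sInf S) := hm.eq_or_lt.elim (fun h => h ▸ h₀) fun h => hleft _ h hlt
  have hgt : ∀ s ∈ S, sInf S < s := fun s hs =>
    (csInf_le hbd hs).lt_of_ne fun h => hs.2 (h ▸ hPm)
  obtain ⟨u, hu, hP⟩ :=
    (mem_nhdsGT_iff_exists_Ioo_subset' (hgt _ hne.some_mem)).1 (hright _ hm hPm)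
  obtain ⟨s, hs, hsu⟩ := exists_lt_of_csInf_lt hne hu
  exact hs.2 (hP ⟨hgt s hs, hsu⟩)

end TimeInduction

section MeasurableDistance

variable {N : ℕ} {E : Set (Space N × ℝ)}

theorem measurableSet_of_isSigmaCompact {X : Type*} [TopologicalSpace X] [T2Space X]
    [MeasurableSpace X] [OpensMeasurableSpace X] {s : Set X} (hs : IsSigmaCompact s) :
    MeasurableSet s := by
  obtain ⟨K, hK, rfl⟩ := hs
  exact MeasurableSet.iUnion fun n => (hK n).measurableSet

theorem isClosed_slice (hE : IsClosed E) (t : ℝ) : IsClosed (slice E t) :=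
  hE.preimage (by fun_prop : Continuous fun x : Space N => (x, t))

theorem measurableSet_exists_dist_le (hE : IsClosed E) (c : ℝ) :
    MeasurableSet {p : Space N × ℝ | ∃ y ∈ slice E p.2, dist p.1 y ≤ c} := by
  have hclosed : IsClosed {q : (Space N × ℝ) × Space N |
      (q.2, q.1.2) ∈ E ∧ dist q.1.1 q.2 ≤ c} :=
    (hE.preimage (by fun_prop : Continuous fun q : (Space N × ℝ) × Space N => (q.2, q.1.2))).inter
      (isClosed_le (by fun_prop : Continuous fun q : (Space N × ℝ) × Space N => dist q.1.1 q.2)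
        continuous_const)
  convert measurableSet_of_isSigmaCompact
    ((isSigmaCompact_univ.of_isClosed_subset hclosed (subset_univ _)).image continuous_fst)
  ext p
  simp [slice]

theorem measurableSet_slice_nonempty (hE : IsClosed E) :
    MeasurableSet {p : Space N × ℝ | (slice E p.2).Nonempty} := by
  convert MeasurableSet.iUnion fun n : ℕ => measurableSet_exists_dist_le hE n
  ext p
  simp only [mem_ofPred_eq, mem_iUnion]
  exact ⟨fun ⟨y, hy⟩ => (exists_nat_ge (dist p.1 y)).imp fun n hn => ⟨y, hy, hn⟩,
    fun ⟨_, y, hy, _⟩ => ⟨y, hy⟩⟩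

theorem measurable_distTo (hE : IsClosed E) : Measurable (distTo E) := by
  refine measurable_of_Iic fun c => ?_
  rcases lt_or_ge c 0 with hc | hc
  · convert MeasurableSet.empty
    exact eq_empty_of_forall_notMem fun p hp => hc.not_ge (Metric.infDist_nonneg.trans hp)
  convert (measurableSet_slice_nonempty hE).compl.union (measurableSet_exists_dist_le hE c)
  ext p
  rcases (slice E p.2).eq_empty_or_nonempty with hp | hp
  · simp [distTo, hp, hc]
  · obtain ⟨y, hy, hdist⟩ := (isClosed_slice hE p.2).exists_infDist_eq_dist hp p.1
    simp only [mem_preimage, mem_Iic, mem_union, mem_compl_iff, mem_ofPred_eq, hp,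
      not_true_eq_false, false_or]
    exact ⟨fun hle => ⟨y, hy, hdist ▸ hle⟩,
      fun ⟨w, hw, hle⟩ => (Metric.infDist_le_dist_of_mem hw).trans hle⟩

end MeasurableDistance

section Superflow

variable {N : ℕ} {r Δ : ℝ} {E0 G0 : Set (Space N)} {E G : Set (Space N × ℝ)}

theorem le_extinctionTime {t : ℝ} (h : (slice E t).Nonempty) : (t : EReal) ≤ extinctionTime E :=
  le_iInf₂ fun _ hs => EReal.coe_le_coe_iff.2 (not_lt.1 fun hst => h.ne_empty (hs.2 t hst.le))

theorem univ_prod_Ioo_subset_spaceTimeCylinder {a b : ℝ} (ha : 0 ≤ a) {T : EReal} (hb : b ≤ T) :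
    univ ×ˢ Ioo a b ⊆ spaceTimeCylinder N T := fun _ hp =>
  ⟨ha.trans_lt hp.2.1, (EReal.coe_lt_coe_iff.2 hp.2.2).trans_le hb⟩

theorem measurableSet_spaceTimeCylinder (T : EReal) : MeasurableSet (spaceTimeCylinder N T) :=
  (measurableSet_lt measurable_const measurable_snd).inter
    (measurableSet_lt (measurable_coe_real_ereal.comp measurable_snd) measurable_const)

theorem IsNonlocalDivergence.pairing_eq_setIntegral_diffPairing {T : EReal}
    {z : Space N × ℝ → Measure (Space N × Space N)} {μpos μneg : Measure (Space N × ℝ)}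
    (h : IsNonlocalDivergence r T z μpos μneg) {a b : ℝ}
    (hcyl : univ ×ˢ Ioo a b ⊆ spaceTimeCylinder N T) {φ : Space N × ℝ → ℝ}
    (hφ : Continuous φ) (hc : HasCompactSupport φ) (hsupp : tsupport φ ⊆ univ ×ˢ Ioo a b) :
    (∫ p, φ p ∂μpos) - (∫ p, φ p ∂μneg) = -(1 / (2 * r)) *
      ∫ p in univ ×ˢ Ioo a b, diffPairing (fun x => φ (x, p.2)) p.1 (z p) := by
  rw [h.pairing φ hφ hc (hsupp.trans hcyl)]
  congr 1
  refine setIntegral_eq_of_subset_of_forall_sdiff_eq_zero (measurableSet_spaceTimeCylinder T)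
    hcyl fun p hp => ?_
  have hzero : ∀ x, φ (x, p.2) = 0 := fun x =>
    image_eq_zero_of_notMem_tsupport fun hx => hp.2 ⟨mem_univ _, (hsupp hx).2⟩
  simp [hzero]

theorem IsMeasureField.isSubprobabilityField {T : EReal}
    {z : Space N × ℝ → Measure (Space N × Space N)} (hz : IsMeasureField r T z)
    (hmass : ∀ᵐ p ∂volume.restrict (spaceTimeCylinder N T), z p (Cr N r) ≤ 1) :
    IsSubprobabilityField r (volume.restrict (spaceTimeCylinder N T)) z where
  aemeasurable := hz.measurable
  subprobability := by
    filter_upwards [hmass, ae_restrict_mem (measurableSet_spaceTimeCylinder T)] with p hp hpT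
    refine ⟨?_, hz.concentrated p hpT⟩
    have hCr : MeasurableSet (Cr N r) :=
      measurableSet_closedBall.prod measurableSet_closedBall
    rwa [← measure_add_measure_compl hCr, hz.concentrated p hpT, add_zero]

theorem IsSubprobabilityField.mono_measure {ν ν' : Measure (Space N × ℝ)}
    {z : Space N × ℝ → Measure (Space N × Space N)} (h : IsSubprobabilityField r ν z)
    (hν : ν' ≤ ν) : IsSubprobabilityField r ν' z where
  aemeasurable := fun f hf => (h.aemeasurable f hf).mono_measure hν
  subprobability := ae_mono hν h.subprobability

namespace IsWeakSuperflow

theorem eventually_subset_thickening (hE : IsWeakSuperflow r E0 E) {t δ : ℝ} (ht : 0 ≤ t)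
    (hδ : 0 < δ) : ∀ᶠ s in 𝓝[>] t, slice E s ⊆ Metric.thickening δ (slice E t) := by
  obtain ⟨τ, hτ, h⟩ := hE.right t ht δ hδ
  filter_upwards [Ioo_mem_nhdsGT (lt_add_of_pos_right t hτ)] with s hs using h s hs

theorem eventually_le_distTo (hE : IsWeakSuperflow r E0 E) {t δ : ℝ} (ht : 0 ≤ t) (hδ : 0 < δ) :
    ∀ᶠ s in 𝓝[>] t, (slice E s).Nonempty → ∀ x, distTo E (x, t) - δ ≤ distTo E (x, s) :=
  (hE.eventually_subset_thickening ht hδ).mono fun s hs hne =>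
    infDist_sub_le_of_subset_thickening (A := slice E s) (B := slice E t) hne hs

theorem exists_kuratowskiTendsto (hE : IsWeakSuperflow r E0 E) (hG : IsWeakSuperflow r G0 G)
    {t₀ t : ℝ} (ht₀ : 0 ≤ t₀) (ht : t₀ < t) : ∃ s : ℕ → ℝ, (∀ n, s n ∈ Ioo t₀ t) ∧
      KuratowskiTendsto (fun n => slice E (s n)) (slice E t) ∧
      KuratowskiTendsto (fun n => slice G (s n)) (slice G t) := by
  obtain ⟨s, -, hs, hlim⟩ := exists_seq_strictMono_tendsto' ht
  have hs' : ∀ n, 0 ≤ s n ∧ s n < t := fun n => ⟨ht₀.trans (hs n).1.le, (hs n).2⟩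
  exact ⟨s, hs, hE.left t (ht₀.trans_lt ht) s hs' hlim, hG.left t (ht₀.trans_lt ht) s hs' hlim⟩

theorem slice_eq_empty_of_le (hE : IsWeakSuperflow r E0 E) {s t : ℝ} (hs : 0 ≤ s) (hst : s ≤ t)
    (h : slice E s = ∅) : slice E t = ∅ := by
  refine forall_ge_of_propagation (P := fun t => slice E t = ∅) h (fun τ hτ hempty => ?_)
    (fun τ hτ hempty => ?_) t hst
  · obtain ⟨σ, hσ, hK, -⟩ := hE.exists_kuratowskiTendsto hE hs hτ
    refine eq_empty_of_forall_notMem fun x hx => ?_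
    obtain ⟨u, hu, -⟩ := hK.2 x hx
    exact (hempty (σ 0) (Ioo_subset_Ico_self (hσ 0))).subset (hu 0)
  · filter_upwards [hE.eventually_subset_thickening (hs.trans hτ) one_pos] with σ hσ
    rwa [hempty, Metric.thickening_empty, subset_empty_iff] at hσ

theorem slice_nonempty_of_le (hE : IsWeakSuperflow r E0 E) {s t : ℝ} (hs : 0 ≤ s) (hst : s ≤ t)
    (h : (slice E t).Nonempty) : (slice E s).Nonempty :=
  nonempty_iff_ne_empty.2 fun hempty => h.ne_empty (hE.slice_eq_empty_of_le hs hst hempty)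

theorem continuousWithinAt_distTo (hE : IsWeakSuperflow r E0 E) {t : ℝ} (ht : 0 < t)
    (hne : (slice E t).Nonempty) (x : Space N) :
    ContinuousWithinAt (fun s => distTo E (x, s)) (Iic t) t := by
  refine continuousWithinAt_Iio_iff_Iic.1 (tendsto_of_seq_tendsto fun s hs => ?_)
  obtain ⟨n₀, hn₀⟩ := eventually_atTop.1 (hs.eventually (Ioo_mem_nhdsLT ht))
  have hmem : ∀ n, s (n + n₀) ∈ Ioo 0 t := fun n => hn₀ _ (Nat.le_add_left n₀ n)
  refine (tendsto_add_atTop_iff_nat n₀).1 (KuratowskiTendsto.tendsto_infDist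
    (hE.left t ht (fun n => s (n + n₀)) (fun n => ⟨(hmem n).1.le, (hmem n).2⟩)
      ((tendsto_add_atTop_iff_nat n₀).2 (hs.mono_right nhdsWithin_le_nhds)))
    (fun n => hE.slice_nonempty_of_le (hmem n).1.le (hmem n).2.le hne) hne x)

theorem exists_isLocalSupersolution (hE : IsWeakSuperflow r E0 E) {l : ℝ} (hl : 0 < l) :
    ∃ (z : Space N × ℝ → Measure (Space N × Space N)) (M : ℝ≥0), ∀ C U a b, M ≤ C → IsOpen U →
      0 ≤ a → (slice E b).Nonempty → (∀ x ∈ U, ∀ s ∈ Ioo a b, l ≤ distTo E (x, s)) →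
      IsLocalSupersolution r C U a b (distTo E) z := by
  obtain ⟨z, μpos, μneg, hz, hdiv, hloc, hweak, hosc, hac⟩ := hE.field
  obtain ⟨M, hM⟩ := hac l hl
  refine ⟨z, M, fun C U a b hMC hU ha hb hUl => ?_⟩
  have hcyl := univ_prod_Ioo_subset_spaceTimeCylinder (N := N) ha (le_extinctionTime hb)
  have hrestrict := Measure.restrict_mono hcyl (le_refl (volume : Measure (Space N × ℝ)))
  have hUuniv : U ×ˢ Ioo a b ⊆ univ ×ˢ Ioo a b := prod_mono_left (subset_univ U)
  have hUcyl := hUuniv.trans hcyl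
  have hUE : U ×ˢ Ioo a b ⊆ spaceTimeCylinder N (extinctionTime E) \ E := fun p hp =>
    ⟨hUcyl hp, fun hpE => hl.not_ge
      ((hUl p.1 hp.1 p.2 hp.2).trans_eq (Metric.infDist_zero_of_mem (s := slice E p.2) hpE))⟩
  have hbound : μpos.restrict (U ×ˢ Ioo a b) ≤ C • volume := by
    refine (Measure.restrict_mono (fun p hp => ?_) le_rfl).trans
      (hM.trans (Measure.le_iff.2 fun s _ => ?_))
    · exact ⟨hUcyl hp, hUl p.1 hp.1 p.2 hp.2⟩
    · simp only [Measure.smul_apply]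
      exact mul_le_mul' (ENNReal.coe_le_coe.2 hMC) le_rfl
  exact {
    isOpen := hU
    measurable := measurable_distTo hE.closed
    nonneg := fun p => Metric.infDist_nonneg
    lipschitz := fun t => Metric.lipschitz_infDist_pt (slice E t)
    left := fun t ht => hE.continuousWithinAt_distTo (ha.trans_lt ht.1)
      (hE.slice_nonempty_of_le (ha.trans ht.1.le) ht.2.le hb)
    field := (hz.isSubprobabilityField (hosc.mono fun p hp => hp.1)).mono_measure hrestrict
    attains := ae_mono hrestrict (hosc.mono fun p hp => hp.2)
    divergence := ⟨μpos, μneg,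
      { integrableOn := fun K hK hKU => hloc.integrableOn_compact_subset (hKU.trans hUE) hK
        pos_lt_top := fun K hK hKU => hdiv.pos_radon K hK (hKU.trans hUcyl)
        neg_lt_top := fun K hK hKU => hdiv.neg_radon K hK (hKU.trans hUcyl)
        pairing_le := fun φ hφ hc hsupp => hweak φ hφ hc (hsupp.trans hUE) },
      hbound,
      fun φ hφ hc hsupp =>
        hdiv.pairing_eq_setIntegral_diffPairing hcyl hφ hc (hsupp.trans hUuniv)⟩ }

theorem separated_of_left (hE : IsWeakSuperflow r E0 E) (hG : IsWeakSuperflow r G0 G) {t₀ t : ℝ}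
    (ht₀ : 0 ≤ t₀) (ht : t₀ < t) (h : ∀ s ∈ Ioo t₀ t, Separated Δ (slice E s) (slice G s)) :
    Separated Δ (slice E t) (slice G t) := by
  intro x hx y hy
  obtain ⟨s, hs, hKE, hKG⟩ := hE.exists_kuratowskiTendsto hG ht₀ ht
  obtain ⟨u, hu, hulim⟩ := hKE.2 x hx
  obtain ⟨v, hv, hvlim⟩ := hKG.2 y hy
  exact ge_of_tendsto' (hulim.dist hvlim) fun n => h _ (hs n) _ (hu n) _ (hv n)

theorem isBounded_or_isBounded (hE : IsWeakSuperflow r E0 E) {t : ℝ} (ht : 0 ≤ t)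
    {B : Set (Space N)} (h : Disjoint (slice E t) B) :
    Bornology.IsBounded (slice E t) ∨ Bornology.IsBounded B :=
  hE.bounded.imp (fun hb => hb t ht) fun hb => (hb t ht).subset h.subset_compl_left

theorem eventually_le_distTo_add (hE : IsWeakSuperflow r E0 E) (hG : IsWeakSuperflow r G0 G)
    {t₀ m : ℝ} (ht₀ : 0 ≤ t₀) (h : Separated Δ (slice E t₀) (slice G t₀)) (hm : 0 < m) :
    ∀ᶠ s in 𝓝[>] t₀, (slice E s).Nonempty → (slice G s).Nonempty →
      ∀ x, Δ - m ≤ distTo E (x, s) + distTo G (x, s) := by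
  filter_upwards [hE.eventually_le_distTo ht₀ (half_pos hm),
    hG.eventually_le_distTo ht₀ (half_pos hm), self_mem_nhdsWithin] with s hEs hGs hs hneE hneG x
  have hsum : Δ ≤ distTo E (x, t₀) + distTo G (x, t₀) :=
    h.le_infDist_add (hE.slice_nonempty_of_le ht₀ (le_of_lt hs) hneE)
      (hG.slice_nonempty_of_le ht₀ (le_of_lt hs) hneG) x
  linarith [hEs hneE x, hGs hneG x]

theorem exists_isComparisonPair (hE : IsWeakSuperflow r E0 E) (hG : IsWeakSuperflow r G0 G)
    {t₀ δ : ℝ} (ht₀ : 0 ≤ t₀) (hΔ : 0 ≤ Δ) (hδ : 0 < δ)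
    (h : Separated Δ (slice E t₀) (slice G t₀)) (hb : Bornology.IsBounded (slice E t₀)) :
    ∃ (C : ℝ≥0) (K U : Set (Space N)) (z₁ z₂ : Space N × ℝ → Measure (Space N × Space N)),
      ∀ᶠ t in 𝓝[>] t₀, (slice E t).Nonempty → (slice G t).Nonempty →
        IsComparisonPair r Δ C (fun s => 4 * δ + C * (s - t₀)) K U t₀ t (distTo E) (distTo G)
          z₁ z₂ := by
  obtain ⟨z₁, M₁, hz₁⟩ := hE.exists_isLocalSupersolution hδ
  obtain ⟨z₂, M₂, hz₂⟩ := hG.exists_isLocalSupersolution hδ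
  let U := {x | 2 * δ < distTo E (x, t₀) ∧ 2 * δ < distTo G (x, t₀)}
  have hU : IsOpen U :=
    (isOpen_lt continuous_const (Metric.continuous_infDist_pt (slice E t₀))).inter
      (isOpen_lt continuous_const (Metric.continuous_infDist_pt (slice G t₀)))
  refine ⟨max M₁ M₂, strip (3 * δ) Δ (slice E t₀) (slice G t₀), U, z₁, z₂, ?_⟩
  filter_upwards [self_mem_nhdsWithin,
    eventually_nhdsGT_forall_Ioo (hE.eventually_le_distTo ht₀ hδ),
    eventually_nhdsGT_forall_Ioo (hG.eventually_le_distTo ht₀ hδ)] with t ht hEt hGt hneE hneG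
  have hneE' : ∀ s ∈ Ico t₀ t, (slice E s).Nonempty := fun s hs =>
    hE.slice_nonempty_of_le (ht₀.trans hs.1) hs.2.le hneE
  have hneG' : ∀ s ∈ Ico t₀ t, (slice G s).Nonempty := fun s hs =>
    hG.slice_nonempty_of_le (ht₀.trans hs.1) hs.2.le hneG
  have hdE := fun s hs => hEt s hs (hneE' s (Ioo_subset_Ico_self hs))
  have hdG := fun s hs => hGt s hs (hneG' s (Ioo_subset_Ico_self hs))
  have hsum : ∀ x, Δ ≤ distTo E (x, t₀) + distTo G (x, t₀) := fun x =>
    h.le_infDist_add (hneE' t₀ ⟨le_rfl, ht⟩) (hneG' t₀ ⟨le_rfl, ht⟩) x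
  exact {
    nonneg := hΔ
    continuous_level := by fun_prop
    level_growth := fun s σ _ => by linarith
    isCompact := isCompact_strip (hneE' t₀ ⟨le_rfl, ht⟩) hb
    subset := fun x hx => ⟨lt_of_lt_of_le (by linarith) hx.1, lt_of_lt_of_le (by linarith) hx.2.1⟩
    fst := hz₁ _ U t₀ t (le_max_left _ _) hU ht₀ hneE fun x hx s hs => by
      linarith [hdE s hs x, hx.1]
    snd := hz₂ _ U t₀ t (le_max_right _ _) hU ht₀ hneG fun x hx s hs => by
      linarith [hdG s hs x, hx.2]
    mem_of_lt := fun x s hs hlt => by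
      have hlevel : 0 ≤ (max M₁ M₂ : ℝ≥0) * (s - t₀) :=
        mul_nonneg (NNReal.coe_nonneg _) (sub_nonneg.2 hs.1.le)
      exact mem_strip (by positivity) (by linarith) (hsum x) (hdE s hs x) (hdG s hs x) hlt }

theorem eventually_separated (hE : IsWeakSuperflow r E0 E) (hG : IsWeakSuperflow r G0 G)
    (hr : 0 < r) (hΔ : 0 < Δ) {t₀ : ℝ} (ht₀ : 0 ≤ t₀) (h : Separated Δ (slice E t₀) (slice G t₀))
    (hb : Bornology.IsBounded (slice E t₀)) :
    ∀ᶠ t in 𝓝[>] t₀, Separated Δ (slice E t) (slice G t) := by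
  obtain ⟨C, K, U, z₁, z₂, hpair⟩ :=
    hE.exists_isComparisonPair hG (δ := Δ / 16) ht₀ hΔ.le (by positivity) h hb
  have hlevel : ∀ᶠ s in 𝓝[>] t₀, 2 * (4 * (Δ / 16) + C * (s - t₀)) < Δ :=
    nhdsWithin_le_nhds ((by fun_prop : Continuous fun s =>
      2 * (4 * (Δ / 16) + C * (s - t₀))).continuousAt.eventually_lt_const (by
        simp only [sub_self, mul_zero]
        linarith))
  filter_upwards [self_mem_nhdsWithin, hpair, eventually_nhdsGT_forall_Ioo hlevel]
    with t ht hpair hlevel x hx y hy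
  have hinit : ∀ m > 0, ∀ᶠ s in 𝓝[>] t₀, ∀ x, Δ - m ≤ distTo E (x, s) + distTo G (x, s) := by
    intro m hm
    filter_upwards [hE.eventually_le_distTo_add hG ht₀ h hm, Ioo_mem_nhdsGT ht] with s hsum hs
    exact hsum (hE.slice_nonempty_of_le (ht₀.trans hs.1.le) hs.2.le ⟨x, hx⟩)
      (hG.slice_nonempty_of_le (ht₀.trans hs.1.le) hs.2.le ⟨y, hy⟩)
  exact hE.separated_of_left hG ht₀ ht (fun s hs => separated_of_le_max_add_max (hlevel s hs)
    fun w => (hpair ⟨x, hx⟩ ⟨y, hy⟩).le_max_add_max hr hinit hs w) x hx y hy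

theorem separated (hE : IsWeakSuperflow r E0 E) (hG : IsWeakSuperflow r G0 G) (hr : 0 < r)
    (hΔ : 0 < Δ) (h : Separated Δ (slice E 0) (slice G 0)) {t : ℝ} (ht : 0 ≤ t) :
    Separated Δ (slice E t) (slice G t) := by
  refine forall_ge_of_propagation (P := fun t => Separated Δ (slice E t) (slice G t)) h
    (fun t ht hs => hE.separated_of_left hG le_rfl ht fun s hs' => hs s (Ioo_subset_Ico_self hs'))
    (fun t ht hs => ?_) t ht
  rcases hE.isBounded_or_isBounded ht (hs.disjoint hΔ) with hb | hb
  · exact hE.eventually_separated hG hr hΔ ht hs hb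
  · exact (hG.eventually_separated hE hr hΔ ht hs.symm hb).mono fun s hs => hs.symm

end IsWeakSuperflow

end Superflow

end MinkowskiFlow

theorem theorem3p11_general (N : ℕ) (r : ℝ) (hr : 0 < r) (E0 F0 : Set (MinkowskiFlow.Space N))
    (E F : Set (MinkowskiFlow.Space N × ℝ)) (hE : MinkowskiFlow.IsWeakSuperflow r E0 E)
    (hF : MinkowskiFlow.IsWeakSubflow r F0 F) (t : ℝ) (ht : 0 ≤ t) :
    MinkowskiFlow.setDist E0 F0ᶜ ≤
      MinkowskiFlow.setDist (MinkowskiFlow.slice E t) (MinkowskiFlow.slice F t)ᶜ := by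
  refine ENNReal.le_of_forall_nnreal_lt fun c hc => ?_
  rcases eq_or_ne c 0 with rfl | hc0
  · exact zero_le
  have hinit : MinkowskiFlow.Separated c (MinkowskiFlow.slice E 0)
      (MinkowskiFlow.slice (MinkowskiFlow.halfSpace N \ F) 0) :=
    (MinkowskiFlow.le_setDist_iff.1 hc.le).closure_right.mono hE.initial
      (hF.compl.initial.trans closure_compl.superset)
  have hsep := hE.separated hF.compl hr (by positivity) hinit ht
  exact MinkowskiFlow.le_setDist_iff.2 fun x hx y hy => hsep x hx y ⟨ht, hy⟩

theorem theorem3p11 (N : ℕ) (r : ℝ) (hr : 0 < r)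
    (E0 F0 : Set (MinkowskiFlow.Space N))
    (hE0 : IsClosed E0) (hE0b : IsCompact (frontier E0))
    (hF0 : IsClosed F0) (hF0b : IsCompact (frontier F0))
    (E F : Set (MinkowskiFlow.Space N × ℝ))
    (hE : MinkowskiFlow.IsWeakSuperflow r E0 E)
    (hF : MinkowskiFlow.IsWeakSubflow r F0 F)
    (hΔ : 0 < MinkowskiFlow.setDist E0 F0ᶜ) :
    ∀ t : ℝ, 0 ≤ t →
      MinkowskiFlow.setDist E0 F0ᶜ ≤
        MinkowskiFlow.setDist (MinkowskiFlow.slice E t) (MinkowskiFlow.slice F t)ᶜ :=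
  theorem3p11_general N r hr E0 F0 E F hE hF
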